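/- **Setting.** Let $G\in\mathbb R^{n\times n}$ be stable (spectral radius $<1$), let $\Pi=[e_{k_1},\dots,e_{k_r}]$ and $C=[e_{j_1},\dots,e_{j_m}]^{\top}$ for distinct input nodes $k_1,\dots,k_r$ and distinct sensor nodes $j_1,\dots,j_m$ in $\{1,\dots,n\}$, and let $x[0]=0$, $x[k+1]=Gx[k]+\Pi w[k]$, $y[k]=Cx[k]+v[k]$, where the $v[k]$ are i.i.d. $\mathcal N(0,\sigma_v^2I)$, independent of the inputs $w$. Under hypothesis $H_i$ ($i=1,2$), which has prior probability $1/2$, the inputs $w[k]$ are i.i.d. $\mathcal N(\mu_i\mathbf 1,\sigma_i^2D)$, where $D\succ0$. Let $Y=(y[1],\dots,y[N])$, with mean $\bar\mu_i$ and covariance $\bar\Sigma_i$ under $H_i$. The MAP detector based on an observation decides for the hypothesis with the larger posterior probability. An LD-MAP detector is the MAP detector based on $b^{\top}Y$, where $b$ maximizes $$I(b)=\tfrac12\,\mathrm{KL}\big(\mathcal L(b^{\top}Y\mid H_1)\,\|\,\mathcal L(b^{\top}Y\mid H_2)\big)+\tfrac12\,\mathrm{KL}\big(\mathcal L(b^{\top}Y\mid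 H_2)\,\|\,\mathcal L(b^{\top}Y\mid H_1)\big)$$ and $I(b)>0$. Error probabilities are averaged over the two hypotheses. Write $T(z)=C(zI-G)^{-1}\Pi$, $L=T(1)D^{1/2}$ with the positive square root $D^{1/2}$, $\mu_\Delta=\mu_2-\mu_1$, $\|F\|_\infty=\operatorname{ess\,sup}_{|z|=1}\|F(z)\|_2$, $Q_{\mathcal N}(t)=\Pr[Z\ge t]$ and $Q_{\chi^2}(1,t)=\Pr[Z^2\ge t]$ for $Z\sim\mathcal N(0,1)$. **(1) Mean shift.** Let $\sigma_1=\sigma_2=\sigma_c>0$, $\sigma_v>0$, and $G^k=0$ for some $k\in\mathbb N$. Put $\bar\Sigma_c=\bar\Sigma_1=\bar\Sigma_2$, $\hat\eta^2=(\bar\mu_2-\bar\mu_1)^{\top}\bar\Sigma_c^{-1}(\bar\mu_2-\bar\mu_1)$ and $$\eta_s^2=N\mu_\Delta^2\,\mathbf 1^{\top}D^{-1/2}\,[\sigma_c^2L^{\top}L+\sigma_v^2I]^{-1}L^{\top}L\,D^{-1/2}\mathbf 1 .$$ For all $N,\mu_1,\mu_2$ the error probability of the MAP detector based on $Y$ is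 $Q_{\mathcal N}(\tfrac12\hat\eta)$. There is a constant $c_0$, independent of $N,\mu_1,\mu_2$, with $|\hat\eta^2-\eta_s^2|\le c_0\,\mu_\Delta^2$. Consequently, if $\mu_1,\mu_2$ depend on $N$ and $\mu_\Delta\to0$ as $N\to\infty$ (in particular if $N\|\mu_2\mathbf 1-\mu_1\mathbf 1\|_2\to c$ with $0<c<\infty$), then $\hat\eta^2-\eta_s^2\to0$, and the difference between the error probability and $Q_{\mathcal N}(\tfrac12\eta_s)$ tends to $0$. **(2) Covariance shift.** Let $\mu_1=\mu_2$, $\sigma_1,\sigma_2\ge0$, $\sigma_1^2>\sigma_2^2$, $\sigma_v\ge0$, with $\sigma_v>0$ or $\sigma_2>0$. If $\|T(z)D^{1/2}\|_\infty>0$, then an LD-MAP detector exists for all large $N$. If for all large $N$ the vector $b_N$ defines an LD-MAP detector, then, as $N\to\infty$, $$\hat R=\frac{b_N^{\top}\bar\Sigma_1b_N}{b_N^{\top}\bar\Sigma_2b_N}\;\longrightarrow\;R_s=\frac{\sigma_1^2\|T(z)D^{1/2}\|_\infty^2+\sigma_v^2}{\sigma_2^2\|T(z)D^{1/2}\|_\infty^2+\sigma_v^2},$$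 and the error probability of the LD-MAP detector tends to $\tfrac12[1-Q_{\chi^2}(1,\tau)]+\tfrac12Q_{\chi^2}(1,\tau R_s)$ with $\tau=\ln R_s/(R_s-1)$. -/

import Mathlib

open MeasureTheory ProbabilityTheory InformationTheory Filter Topology
open scoped ENNReal NNReal Matrix

namespace NetDet

noncomputable section

/-! ### The network -/

/-- The matrix `[e_{s 0}, …, e_{s (q-1)}]` whose columns are the standard basis vectors of the
selected nodes. -/
def selection (𝕜 : Type*) [Zero 𝕜] [One 𝕜] {n q : ℕ} (s : Fin q ↪ Fin n) :
    Matrix (Fin n) (Fin q) 𝕜 :=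
  Matrix.of fun i a => if i = s a then 1 else 0

/-- The network state: `x[0] = 0`, `x[k+1] = G x[k] + Π w[k]`, with `Π` selecting the input
nodes `K`. -/
def state {n r : ℕ} (G : Matrix (Fin n) (Fin n) ℝ) (K : Fin r ↪ Fin n)
    (w : ℕ → EuclideanSpace ℝ (Fin r)) : ℕ → (Fin n → ℝ)
  | 0 => 0
  | k + 1 => G *ᵥ state G K w k + selection ℝ K *ᵥ (w k).ofLp

/-- The stacked measurements `Y = (y[1], …, y[N])`, `y[k] = C x[k] + v[k]`, with `Cᵀ` selecting
the sensor nodes `J`. -/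
def measurements {n r m : ℕ} (G : Matrix (Fin n) (Fin n) ℝ) (K : Fin r ↪ Fin n)
    (J : Fin m ↪ Fin n) (N : ℕ)
    (p : (ℕ → EuclideanSpace ℝ (Fin r)) × (ℕ → EuclideanSpace ℝ (Fin m))) :
    EuclideanSpace ℝ (Fin N × Fin m) :=
  WithLp.toLp 2 fun a =>
    ((selection ℝ J)ᵀ *ᵥ state G K p.1 (a.1 + 1)) a.2 + p.2 (a.1 + 1) a.2

/-- The law of the stacked measurements when the inputs `w[k]` are i.i.d. `N(μ, S)`, and the
sensor noises `v[k]` are i.i.d. `N(0, σᵥ² I)`, independent of the inputs. -/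
def measurementLaw {n r m : ℕ} (G : Matrix (Fin n) (Fin n) ℝ) (K : Fin r ↪ Fin n)
    (J : Fin m ↪ Fin n) (σv : ℝ) (N : ℕ) (μ : EuclideanSpace ℝ (Fin r))
    (S : Matrix (Fin r) (Fin r) ℝ) : Measure (EuclideanSpace ℝ (Fin N × Fin m)) :=
  ((Measure.infinitePi fun _ : ℕ => multivariateGaussian μ S).prod
    (Measure.infinitePi fun _ : ℕ =>
      multivariateGaussian 0 (σv ^ 2 • (1 : Matrix (Fin m) (Fin m) ℝ)))).map
    (measurements G K J N)

/-- The hypothesis `w[k] ∼ N(μ 1, σ² D)`: the resulting law of the measurements. -/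
def hypLaw {n r m : ℕ} (G : Matrix (Fin n) (Fin n) ℝ) (K : Fin r ↪ Fin n)
    (J : Fin m ↪ Fin n) (D : Matrix (Fin r) (Fin r) ℝ) (σv : ℝ) (N : ℕ) (μ σ : ℝ) :
    Measure (EuclideanSpace ℝ (Fin N × Fin m)) :=
  measurementLaw G K J σv N (WithLp.toLp 2 fun _ => μ) (σ ^ 2 • D)

/-! ### Detectors -/

/-- The posterior probability (as a function of the observation) of the hypothesis under which
the observation has law `P`, when the two hypotheses have laws `P` and `P'` and both have prior
probability `1/2`. -/
def posterior {E : Type*} [MeasurableSpace E] (P P' : Measure E) : E → ℝ≥0∞ :=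
  fun y => (1 / 2) * P.rnDeriv ((1 / 2 : ℝ≥0∞) • P + (1 / 2 : ℝ≥0∞) • P') y

/-- The observations for which the MAP detector decides for the second hypothesis. -/
def mapRegion {E : Type*} [MeasurableSpace E] (P₁ P₂ : Measure E) : Set E :=
  {y | posterior P₁ P₂ y < posterior P₂ P₁ y}

/-- The error probability of the MAP detector with equal priors. -/
def mapError {E : Type*} [MeasurableSpace E] (P₁ P₂ : Measure E) : ℝ :=
  (1 / 2) * P₁.real (mapRegion P₁ P₂) + (1 / 2) * P₂.real (mapRegion P₁ P₂)ᶜ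

/-- The law of the discriminant `bᵀ Y`. -/
def discriminantLaw {κ : Type*} [Fintype κ] (P : Measure (EuclideanSpace ℝ κ))
    (b : EuclideanSpace ℝ κ) : Measure ℝ :=
  P.map fun y => ∑ a, b a * y a

/-- The information divergence of the discriminant `bᵀ Y`, with equal priors. -/
def iDivergence {κ : Type*} [Fintype κ] (P₁ P₂ : Measure (EuclideanSpace ℝ κ))
    (b : EuclideanSpace ℝ κ) : ℝ≥0∞ :=
  (1 / 2) * klDiv (discriminantLaw P₁ b) (discriminantLaw P₂ b) +
    (1 / 2) * klDiv (discriminantLaw P₂ b) (discriminantLaw P₁ b)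

/-- `b` defines an LD-MAP detector: it maximizes the information divergence, and the maximum is
positive. -/
def IsLDMAP {κ : Type*} [Fintype κ] (P₁ P₂ : Measure (EuclideanSpace ℝ κ))
    (b : EuclideanSpace ℝ κ) : Prop :=
  0 < iDivergence P₁ P₂ b ∧ ∀ b', iDivergence P₁ P₂ b' ≤ iDivergence P₁ P₂ b

/-- The error probability of the LD-MAP detector with discriminant vector `b`. -/
def ldMapError {κ : Type*} [Fintype κ] (P₁ P₂ : Measure (EuclideanSpace ℝ κ))
    (b : EuclideanSpace ℝ κ) : ℝ :=
  mapError (discriminantLaw P₁ b) (discriminantLaw P₂ b)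

/-! ### Finite-horizon signal-to-noise ratios -/

def meanVec {κ : Type*} [Fintype κ] (P : Measure (EuclideanSpace ℝ κ)) : κ → ℝ :=
  fun a => ∫ y, y a ∂P

def covMat {κ : Type*} [Fintype κ] (P : Measure (EuclideanSpace ℝ κ)) : Matrix κ κ ℝ :=
  Matrix.of fun a a' => cov[fun y => y a, fun y => y a'; P]

/-- `(μ̄₂ - μ̄₁)ᵀ Σ̄⁻¹ (μ̄₂ - μ̄₁)`, with `Σ̄` the covariance (under the mean shift model it is the
same under both hypotheses). -/
def etaSq {κ : Type*} [Fintype κ] [DecidableEq κ] (P₁ P₂ : Measure (EuclideanSpace ℝ κ)) : ℝ :=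
  (meanVec P₂ - meanVec P₁) ⬝ᵥ (covMat P₁)⁻¹ *ᵥ (meanVec P₂ - meanVec P₁)

/-- `bᵀ Σ̄₁ b / bᵀ Σ̄₂ b`. -/
def ldRatio {κ : Type*} [Fintype κ] (P₁ P₂ : Measure (EuclideanSpace ℝ κ))
    (b : EuclideanSpace ℝ κ) : ℝ :=
  (b.ofLp ⬝ᵥ covMat P₁ *ᵥ b.ofLp) / (b.ofLp ⬝ᵥ covMat P₂ *ᵥ b.ofLp)

/-! ### Transfer matrix, norms and tail functions -/

/-- `T(z) = C (z I - G)⁻¹ Π`, over the field `𝕜` (the reals or the complex numbers). -/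
def transfer (𝕜 : Type*) [Field 𝕜] [Algebra ℝ 𝕜] {n r m : ℕ} (G : Matrix (Fin n) (Fin n) ℝ)
    (K : Fin r ↪ Fin n) (J : Fin m ↪ Fin n) (z : 𝕜) : Matrix (Fin m) (Fin r) 𝕜 :=
  (selection 𝕜 J)ᵀ * (z • (1 : Matrix (Fin n) (Fin n) 𝕜) - G.map (algebraMap ℝ 𝕜))⁻¹ *
    selection 𝕜 K

section
open scoped MatrixOrder

/-- The positive semidefinite square root of a positive semidefinite matrix. -/
def psdSqrt {q : ℕ} (D : Matrix (Fin q) (Fin q) ℝ) : Matrix (Fin q) (Fin q) ℝ :=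
  CFC.sqrt D

end

section
open scoped Matrix.Norms.L2Operator

/-- `‖F‖_∞ = ess sup_{|z| = 1} ‖F(z)‖₂`, with the spectral norm `‖·‖₂`. -/
def hInfNorm {p q : ℕ} (F : ℂ → Matrix (Fin p) (Fin q) ℂ) : ℝ :=
  essSup (fun θ : ℝ => ‖F (Complex.exp (θ * Complex.I))‖)
    (volume.restrict (Set.Icc 0 (2 * Real.pi)))

end

/-- `‖T(z) D^{1/2}‖_∞`. -/
def gain {n r m : ℕ} (G : Matrix (Fin n) (Fin n) ℝ) (K : Fin r ↪ Fin n) (J : Fin m ↪ Fin n)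
    (D : Matrix (Fin r) (Fin r) ℝ) : ℝ :=
  hInfNorm fun z => transfer ℂ G K J z * (psdSqrt D).map (algebraMap ℝ ℂ)

/-- All eigenvalues of `G` lie in the open unit disc. -/
def IsStable {n : ℕ} (G : Matrix (Fin n) (Fin n) ℝ) : Prop :=
  spectralRadius ℂ (G.map (algebraMap ℝ ℂ)) < 1

/-- `Pr[Z ≥ t]` for `Z ∼ N(0, 1)`. -/
def QNormal (t : ℝ) : ℝ := (gaussianReal 0 1).real (Set.Ici t)

/-- `Pr[Z² ≥ t]` for `Z ∼ N(0, 1)`; the law of `Z²` is chi-squared with one degree of freedom. -/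
def QChiSq (t : ℝ) : ℝ := ((gaussianReal 0 1).map fun z => z ^ 2).real (Set.Ici t)

/-! ### The asymptotic signal-to-noise ratios -/

/-- `η_s² = N μ_Δ² uᵀ (σ_c² LᵀL + σ_v² I)⁻¹ LᵀL u`, with `L = T(1) D^{1/2}` and
`u = D^{-1/2} 1`. -/
def etaSqLim {n r m : ℕ} (G : Matrix (Fin n) (Fin n) ℝ) (K : Fin r ↪ Fin n) (J : Fin m ↪ Fin n)
    (D : Matrix (Fin r) (Fin r) ℝ) (σc σv : ℝ) (N : ℕ) (μΔ : ℝ) : ℝ :=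
  let L := transfer ℝ G K J 1 * psdSqrt D
  let u := (psdSqrt D)⁻¹ *ᵥ (fun _ => (1 : ℝ))
  N * μΔ ^ 2 * (u ⬝ᵥ
    ((σc ^ 2 • (Lᵀ * L) + σv ^ 2 • (1 : Matrix (Fin r) (Fin r) ℝ))⁻¹ * (Lᵀ * L)) *ᵥ u)

/-- `R_s = (σ₁² ‖T(z)D^{1/2}‖_∞² + σ_v²) / (σ₂² ‖T(z)D^{1/2}‖_∞² + σ_v²)`. -/
def ratioLim {n r m : ℕ} (G : Matrix (Fin n) (Fin n) ℝ) (K : Fin r ↪ Fin n) (J : Fin m ↪ Fin n)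
    (D : Matrix (Fin r) (Fin r) ℝ) (σ₁ σ₂ σv : ℝ) : ℝ :=
  (σ₁ ^ 2 * gain G K J D ^ 2 + σv ^ 2) / (σ₂ ^ 2 * gain G K J D ^ 2 + σv ^ 2)

end

end NetDet

namespace NetDet

/-! ### The error of the MAP detector through densities -/

section Detection

variable {E : Type*} [MeasurableSpace E]

/-! The stacked measurements are a linear image of independent Gaussians, so each hypothesis gives a
Gaussian law with covariance `σ² A Aᵀ + σᵥ² I`. Here `A = A_N` is block lower triangular Toeplitz
with blocks `C Gᵏ Π D^{1/2}` (`hypLaw_eq`).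

Mean shift. For two Gaussians with common covariance the likelihood ratio test is a linear threshold
test, with error `Q(η̂/2)` (`mapError_multivariateGaussian`). The mean difference is `μ_Δ A u`, with
`u` constant in time. The quadratic form `(A u)ᵀ Σ⁻¹ (A u)` is bounded below by completing the
square and above by a dual splitting of `u`. Both bounds are evaluated at constant trial vectors, on
which `A` acts through partial sums of the impulse response. Nilpotency of `G` makes these partial
sums equal to `L = T(1) D^{1/2}` after finitely many steps, so both bounds are `N` times the same
constant plus `O(1)` (`abs_quadratic_inv_obsCov_sub_le`).

Covariance shift. The scalar `bᵀ Y` is Gaussian with variance `σᵢ² α + σᵥ² β`, where `α = |Aᵀ b|²`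
and `β = |b|²`, and with the same mean under both hypotheses. The symmetrised divergence depends
only on `α / β`, and strictly increases with it when `σᵥ > 0`, so an LD-MAP vector then maximises
the Rayleigh quotient of `A Aᵀ`. It remains to show that `‖A_N‖` tends to the essential supremum of
the symbol: the upper bound is Parseval (`toepl_transpose_sq_le`), the lower bound tests `Aᵀ` on
plane waves and takes Cesàro means (`symbol_norm_le_of_frequently`). The error is a continuous
function of the variance ratio. For `σᵥ = 0` that ratio is constant. -/

theorem mapRegion_withDensity_ae {ν : Measure E} [SigmaFinite ν] {p q : E → ℝ≥0∞}
    (hp : Measurable p) (hq : Measurable q) (hp0 : ∀ x, p x ≠ 0) (hpt : ∀ x, p x ≠ ∞)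
    (hqt : ∀ x, q x ≠ ∞) [IsFiniteMeasure (ν.withDensity p)] [IsFiniteMeasure (ν.withDensity q)] :
    mapRegion (ν.withDensity p) (ν.withDensity q) =ᵐ[ν] {x | p x < q x} := by
  set P := ν.withDensity p with hP
  set P' := ν.withDensity q with hP'
  set Q := (1 / 2 : ℝ≥0∞) • P + (1 / 2 : ℝ≥0∞) • P' with hQ
  have h2 : (1 / 2 : ℝ≥0∞) ≠ 0 := by simp
  have h2t : (1 / 2 : ℝ≥0∞) ≠ ∞ := by simp
  have hQd : Q = ν.withDensity (fun x => (1 / 2) * p x + (1 / 2) * q x) := by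
    have e : (fun x => (1 / 2) * p x + (1 / 2) * q x) =
        (1 / 2 : ℝ≥0∞) • p + (1 / 2 : ℝ≥0∞) • q := by
      ext x; simp
    rw [e, withDensity_add_left (hp.const_smul _), withDensity_smul _ hp, withDensity_smul _ hq]
  have hQm : Measurable (fun x => (1 / 2) * p x + (1 / 2) * q x) := by fun_prop
  have : IsFiniteMeasure Q := by
    rw [hQ]
    constructor
    simp only [Measure.coe_add, Measure.coe_smul, Pi.add_apply, Pi.smul_apply, smul_eq_mul]
    exact ENNReal.add_lt_top.2 ⟨ENNReal.mul_lt_top (by simp) (measure_lt_top _ _),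
      ENNReal.mul_lt_top (by simp) (measure_lt_top _ _)⟩
  have hPQ : P ≪ Q := (Measure.absolutelyContinuous_smul h2).add_right _
  have hPQ' : P' ≪ Q := by
    rw [hQ, add_comm]
    exact (Measure.absolutelyContinuous_smul h2).add_right _
  have e1 := Measure.rnDeriv_mul_rnDeriv (κ := ν) hPQ
  have e2 := Measure.rnDeriv_mul_rnDeriv (κ := ν) hPQ'
  have e3 : Q.rnDeriv ν =ᵐ[ν] _ := hQd ▸ Measure.rnDeriv_withDensity ν hQm
  have e4 : P.rnDeriv ν =ᵐ[ν] p := Measure.rnDeriv_withDensity ν hp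
  have e5 : P'.rnDeriv ν =ᵐ[ν] q := Measure.rnDeriv_withDensity ν hq
  filter_upwards [e1, e2, e3, e4, e5] with x h1 h2' h3 h4 h5
  have hcomm : (1 / 2 : ℝ≥0∞) • P' + (1 / 2 : ℝ≥0∞) • P = Q := add_comm _ _
  rw [Pi.mul_apply, h3, h4] at h1
  rw [Pi.mul_apply, h3, h5] at h2'
  have hw0 : (1 / 2) * p x + (1 / 2) * q x ≠ 0 := by simp [hp0 x]
  have hwt : (1 / 2) * p x + (1 / 2) * q x ≠ ∞ :=
    ENNReal.add_ne_top.2 ⟨ENNReal.mul_ne_top h2t (hpt x), ENNReal.mul_ne_top h2t (hqt x)⟩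
  -- Cancel the prior and multiply both sides by the mixture density `dQ/dν`, which is finite and
  -- nonzero; the chain rule turns the two sides into `p` and `q`.
  have key : posterior P P' x < posterior P' P x ↔ p x < q x := by
    unfold posterior
    rw [hcomm, ← hQ, ENNReal.mul_lt_mul_iff_right h2 h2t,
      ← ENNReal.mul_lt_mul_iff_left hw0 hwt, h1, h2']
  exact propext key

theorem mapError_withDensity {ν : Measure E} [SigmaFinite ν] {p q : E → ℝ≥0∞}
    (hp : Measurable p) (hq : Measurable q) (hp0 : ∀ x, p x ≠ 0) (hpt : ∀ x, p x ≠ ∞)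
    (hqt : ∀ x, q x ≠ ∞) [IsFiniteMeasure (ν.withDensity p)] [IsFiniteMeasure (ν.withDensity q)] :
    mapError (ν.withDensity p) (ν.withDensity q) =
      (1 / 2) * (ν.withDensity p).real {x | p x < q x} +
        (1 / 2) * (ν.withDensity q).real {x | q x ≤ p x} := by
  have h := mapRegion_withDensity_ae (ν := ν) hp hq hp0 hpt hqt
  have hc : {x | q x ≤ p x} = {x | p x < q x}ᶜ := by ext; simp
  unfold mapError
  rw [hc, measureReal_congr ((withDensity_absolutelyContinuous ν p).ae_eq h),
    measureReal_congr ((withDensity_absolutelyContinuous ν q).ae_eq h).compl]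

theorem mapError_self (P : Measure E) [IsProbabilityMeasure P] : mapError P P = 1 / 2 := by
  simp [mapError, mapRegion]

end Detection

/-! ### Gaussian tail functions -/

theorem gaussianReal_symm_real (t : ℝ) :
    (gaussianReal 0 1).real (Set.Iic (-t)) = QNormal t := by
  have h : (gaussianReal 0 1).map (fun x => -x) = gaussianReal 0 1 := by
    rw [gaussianReal_map_neg]; simp
  rw [QNormal, measureReal_def, measureReal_def]
  conv_lhs => rw [← h, Measure.map_apply measurable_neg measurableSet_Iic]
  congr 2
  ext x; simp

theorem noAtoms_gaussian : NullSingletonClass (gaussianReal 0 1) :=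
  nullSingletonClass_gaussianReal one_ne_zero

theorem gaussianPDFReal_std_le_one (x : ℝ) : gaussianPDFReal 0 1 x ≤ 1 := by
  rw [gaussianPDFReal_def]
  have h1 : (√(2 * Real.pi * (1 : ℝ≥0)))⁻¹ ≤ 1 := by
    apply inv_le_one_of_one_le₀
    rw [Real.one_le_sqrt]
    have := Real.pi_gt_three
    simp only [NNReal.coe_one]
    linarith
  have h2 : Real.exp (-(x - 0) ^ 2 / (2 * (1 : ℝ≥0))) ≤ 1 := by
    rw [Real.exp_le_one_iff]
    have : 0 ≤ (x - 0) ^ 2 := sq_nonneg _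
    simp only [NNReal.coe_one]
    linarith
  exact mul_le_one₀ h1 (Real.exp_pos _).le h2

/-- The normal density is at most 1, so an interval has mass at most its length. The uniform
estimate matters later, where the arguments may be unbounded. -/
theorem QNormal_lipschitz (s t : ℝ) : |QNormal s - QNormal t| ≤ |s - t| := by
  wlog hst : s ≤ t generalizing s t
  · rw [abs_sub_comm, abs_sub_comm s]
    exact this t s (not_le.1 hst).le
  have hsplit : QNormal s = (gaussianReal 0 1).real (Set.Ico s t) + QNormal t := by
    rw [QNormal, QNormal, ← measureReal_union _ measurableSet_Ici, Set.Ico_union_Ici_eq_Ici hst]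
    exact Set.disjoint_left.2 fun x hx hx' => not_lt.2 hx' hx.2
  have hb : (gaussianReal 0 1).real (Set.Ico s t) ≤ t - s := by
    rw [measureReal_def, gaussianReal_apply_eq_integral _ one_ne_zero]
    rw [ENNReal.toReal_ofReal (integral_nonneg fun x => gaussianPDFReal_nonneg _ _ _)]
    calc ∫ x in Set.Ico s t, gaussianPDFReal 0 1 x ≤ ∫ x in Set.Ico s t, (1 : ℝ) := by
          apply setIntegral_mono (integrable_gaussianPDFReal _ _).integrableOn
          · exact integrableOn_const (by simp)
          · exact gaussianPDFReal_std_le_one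
      _ = t - s := by simp [hst]
  rw [hsplit, add_sub_cancel_right, abs_of_nonneg measureReal_nonneg, abs_sub_comm,
    abs_of_nonneg (sub_nonneg.2 hst)]
  exact hb

theorem continuous_QNormal : Continuous QNormal := by
  have : LipschitzWith 1 QNormal := LipschitzWith.of_dist_le_mul fun x y => by
    simpa [Real.dist_eq] using QNormal_lipschitz x y
  exact this.continuous

theorem gaussian_Ioi (t : ℝ) : (gaussianReal 0 1).real (Set.Ioi t) = QNormal t := by
  have := noAtoms_gaussian
  exact measureReal_congr Ioi_ae_eq_Ici

theorem gaussian_Iio_neg (t : ℝ) : (gaussianReal 0 1).real (Set.Iio (-t)) = QNormal t := by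
  have := noAtoms_gaussian
  rw [← gaussianReal_symm_real]
  exact measureReal_congr Iio_ae_eq_Iic

theorem QChiSq_def (t : ℝ) : QChiSq t = (gaussianReal 0 1).real {z | t ≤ z ^ 2} := by
  rw [QChiSq, measureReal_def, Measure.map_apply (by fun_prop) measurableSet_Ici]
  rfl

theorem QChiSq_eq {t : ℝ} (ht : 0 < t) : QChiSq t = 2 * QNormal (√t) := by
  have hs : 0 < √t := Real.sqrt_pos.2 ht
  have : {z : ℝ | t ≤ z ^ 2} = Set.Iic (-√t) ∪ Set.Ici (√t) := by
    ext z
    simp only [Set.mem_ofPred_eq, Set.mem_union, Set.mem_Iic, Set.mem_Ici]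
    rw [← Real.sqrt_le_sqrt_iff (sq_nonneg z), Real.sqrt_sq_eq_abs, le_abs, or_comm, le_neg]
  rw [QChiSq_def, this, measureReal_union _ measurableSet_Ici, gaussianReal_symm_real]
  · rw [← QNormal]; ring
  · exact Set.disjoint_left.2 fun x hx hx' => by
      simp only [Set.mem_Iic, Set.mem_Ici] at hx hx'; linarith

theorem continuousAt_QChiSq {t : ℝ} (ht : 0 < t) : ContinuousAt QChiSq t := by
  have h : (fun t => 2 * QNormal (√t)) =ᶠ[𝓝 t] QChiSq := by
    filter_upwards [lt_mem_nhds ht] with s hs using (QChiSq_eq hs).symm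
  exact ContinuousAt.congr
    (continuous_const.mul (continuous_QNormal.comp Real.continuous_sqrt)).continuousAt h

/-! ### Multivariate Gaussian laws -/

section Multivariate

variable {κ : Type*} [Fintype κ] {S : Matrix κ κ ℝ}

theorem inner_toLp_eq (x y : EuclideanSpace ℝ κ) : inner ℝ x y = x.ofLp ⬝ᵥ y.ofLp := by
  rw [EuclideanSpace.inner_eq_star_dotProduct, dotProduct_comm]; rfl

theorem PosSemidef_dotProduct_nonneg (hS : S.PosSemidef) (t : κ → ℝ) : 0 ≤ t ⬝ᵥ S *ᵥ t := by
  simpa using hS.dotProduct_mulVec_nonneg t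

variable [DecidableEq κ]

theorem map_inner_multivariateGaussian (hS : S.PosSemidef) (m t : EuclideanSpace ℝ κ) :
    (multivariateGaussian m S).map (fun x => inner ℝ x t) =
      gaussianReal (inner ℝ m t) (t.ofLp ⬝ᵥ S *ᵥ t.ofLp).toNNReal := by
  have hm : Measurable fun x : EuclideanSpace ℝ κ => inner ℝ x t := by fun_prop
  have : IsProbabilityMeasure ((multivariateGaussian m S).map (fun x => inner ℝ x t)) :=
    Measure.isProbabilityMeasure_map hm.aemeasurable
  apply Measure.ext_of_charFun
  ext s
  have h := charFun_multivariateGaussian (μ := m) hS (s • t)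
  rw [charFun_apply] at h
  rw [charFun_apply, integral_map hm.aemeasurable (by fun_prop), charFun_gaussianReal,
    Real.coe_toNNReal _ (PosSemidef_dotProduct_nonneg hS _)]
  simp only [inner_smul_right, real_inner_smul_left, WithLp.ofLp_smul, smul_dotProduct,
    Matrix.mulVec_smul, dotProduct_smul, smul_eq_mul] at h
  simp only [RCLike.inner_apply, conj_trivial]
  rw [h, real_inner_comm m t]
  congr 1
  push_cast
  ring

theorem mgf_inner_multivariateGaussian (hS : S.PosSemidef) (m t : EuclideanSpace ℝ κ) (s : ℝ) :
    ∫ x, Real.exp (s * inner ℝ x t) ∂multivariateGaussian m S =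
      Real.exp (inner ℝ m t * s + (t.ofLp ⬝ᵥ S *ᵥ t.ofLp) * s ^ 2 / 2) := by
  have := mgf_gaussianReal (map_inner_multivariateGaussian hS m t) s
  rwa [mgf, Real.coe_toNNReal _ (PosSemidef_dotProduct_nonneg hS _)] at this

/-- A non-integrable function has Bochner integral 0, whereas the moment generating function just
computed is positive. -/
theorem integrable_exp_inner_multivariateGaussian (hS : S.PosSemidef)
    (m t : EuclideanSpace ℝ κ) :
    Integrable (fun x => Real.exp (inner ℝ x t)) (multivariateGaussian m S) := by
  have h := mgf_inner_multivariateGaussian hS m t 1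
  simp only [one_mul] at h
  by_contra hn
  rw [integral_undef hn] at h
  exact (Real.exp_pos _).ne h

/-- Exponential tilting in the direction `a` translates a Gaussian by `S a` (Cameron–Martin). Real
moment generating functions of linear functionals are compared first, and characteristic functions
follow by analytic continuation. -/
theorem multivariateGaussian_shift (hS : S.PosSemidef) (m₁ m₂ a : EuclideanSpace ℝ κ)
    (ha : S *ᵥ a.ofLp = (m₂ - m₁).ofLp) :
    multivariateGaussian m₂ S = (multivariateGaussian m₁ S).withDensity
      (fun x => ENNReal.ofReal
        (Real.exp (inner ℝ x a - (inner ℝ m₁ a + (a.ofLp ⬝ᵥ S *ᵥ a.ofLp) / 2)))) := by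
  set k := inner ℝ m₁ a + (a.ofLp ⬝ᵥ S *ᵥ a.ofLp) / 2 with hk
  have hint : Integrable (fun x => Real.exp (inner ℝ x a - k)) (multivariateGaussian m₁ S) := by
    simp only [Real.exp_sub]
    exact (integrable_exp_inner_multivariateGaussian hS m₁ a).div_const _
  have hfin : IsFiniteMeasure ((multivariateGaussian m₁ S).withDensity
      (fun x => ENNReal.ofReal (Real.exp (inner ℝ x a - k)))) :=
    isFiniteMeasure_withDensity_ofReal hint.2
  apply Measure.ext_of_charFun
  ext t
  have hX : mgf (fun x => inner ℝ x t) (multivariateGaussian m₂ S) =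
      mgf (fun x => inner ℝ x t) ((multivariateGaussian m₁ S).withDensity
      (fun x => ENNReal.ofReal (Real.exp (inner ℝ x a - k)))) := by
    ext s
    rw [mgf, mgf, mgf_inner_multivariateGaussian hS,
      integral_withDensity_eq_integral_toReal_smul (by fun_prop) (by simp)]
    have e : ∀ x : EuclideanSpace ℝ κ, (ENNReal.ofReal (Real.exp (inner ℝ x a - k))).toReal •
        Real.exp (s * inner ℝ x t) =
        Real.exp (-k) * Real.exp (1 * inner ℝ x (a + s • t)) := fun x => by
      rw [ENNReal.toReal_ofReal (Real.exp_pos _).le, smul_eq_mul, ← Real.exp_add, ← Real.exp_add,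
        inner_add_right, inner_smul_right]
      ring_nf
    simp_rw [e]
    rw [integral_const_mul, mgf_inner_multivariateGaussian hS, ← Real.exp_add]
    congr 1
    have h1 : t.ofLp ⬝ᵥ S *ᵥ a.ofLp = inner ℝ m₂ t - inner ℝ m₁ t := by
      rw [ha, ← inner_sub_left, real_inner_comm, inner_toLp_eq]
    have h2 : a.ofLp ⬝ᵥ S *ᵥ t.ofLp = t.ofLp ⬝ᵥ S *ᵥ a.ofLp := by
      rw [Matrix.dotProduct_mulVec, ← Matrix.mulVec_transpose, dotProduct_comm]
      congr 2
      simpa using hS.isHermitian.eq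
    simp only [WithLp.ofLp_add, WithLp.ofLp_smul, Matrix.mulVec_add, Matrix.mulVec_smul,
      dotProduct_add, add_dotProduct, smul_dotProduct, dotProduct_smul, smul_eq_mul, h2, h1,
      inner_add_right, inner_smul_right, hk]
    ring
  have hset : integrableExpSet (fun x => inner ℝ x t) (multivariateGaussian m₂ S) = Set.univ := by
    ext s
    simp only [Set.mem_univ, iff_true]
    change Integrable _ _
    have := integrable_exp_inner_multivariateGaussian hS m₂ (s • t)
    simpa only [inner_smul_right] using this
  -- The moment generating function is finite on the whole line, so its complex extension is
  -- determined on the whole plane; its value at `I` is the characteristic function.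
  have h := eqOn_complexMGF_of_mgf hX (x := Complex.I) (by simp [hset])
  simp only [complexMGF] at h
  simp only [charFun_apply]
  simpa only [mul_comm Complex.I] using h

/-- With `a = S⁻¹ (m₂ - m₁)` the log-likelihood ratio is `⟨x, a⟩ - k`. Under both laws `⟨x, a⟩` has
variance `c = aᵀ S a`, and its means are `k - c/2` and `k + c/2`, so each kind of error has
probability `Q(√c / 2)`. -/
theorem mapError_multivariateGaussian (hS : S.PosDef) (m₁ m₂ : EuclideanSpace ℝ κ) :
    mapError (multivariateGaussian m₁ S) (multivariateGaussian m₂ S) =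
      QNormal ((1 / 2) * √((m₂ - m₁).ofLp ⬝ᵥ S⁻¹ *ᵥ (m₂ - m₁).ofLp)) := by
  have hS' := hS.posSemidef
  set d := (m₂ - m₁).ofLp with hd
  set a : EuclideanSpace ℝ κ := WithLp.toLp 2 (S⁻¹ *ᵥ d) with ha
  have hdet : IsUnit S.det := (Matrix.isUnit_iff_isUnit_det _).1 hS.isUnit
  have hSa : S *ᵥ a.ofLp = d := by
    rw [ha, Matrix.mulVec_mulVec, Matrix.mul_nonsing_inv _ hdet, Matrix.one_mulVec]
  have hc : a.ofLp ⬝ᵥ S *ᵥ a.ofLp = d ⬝ᵥ S⁻¹ *ᵥ d := by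
    rw [hSa, dotProduct_comm]
  set c := d ⬝ᵥ S⁻¹ *ᵥ d with hcdef
  have hc0 : 0 ≤ c := hc ▸ PosSemidef_dotProduct_nonneg hS' _
  -- If `c = 0` the two laws coincide and standardisation by `√c` is unavailable; the error is `1/2
  -- = Q(0)` by symmetry.
  rcases hc0.eq_or_lt with h0 | hpos
  · have hd0 : d = 0 := by
      by_contra hne
      have := hS.inv.dotProduct_mulVec_pos hne
      simp only [star_trivial] at this
      exact this.ne h0
    have hm : m₂ = m₁ := by
      have : m₂ - m₁ = 0 := by ext i; exact congrFun hd0 i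
      exact sub_eq_zero.1 this
    rw [hm, mapError_self, ← h0]
    have h1 : (gaussianReal 0 1).real (Set.Iio 0) = QNormal 0 := by
      simpa using gaussian_Iio_neg 0
    have h2 : (gaussianReal 0 1).real (Set.Iio 0) + QNormal 0 = 1 := by
      rw [QNormal, ← Set.compl_Ici, add_comm, measureReal_add_measureReal_compl measurableSet_Ici]
      simp
    simp only [Real.sqrt_zero, mul_zero]
    linarith
  set k := inner ℝ m₁ a + (a.ofLp ⬝ᵥ S *ᵥ a.ofLp) / 2 with hk
  have hshift := multivariateGaussian_shift hS' m₁ m₂ a hSa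
  rw [← hk] at hshift
  have hone : multivariateGaussian m₁ S = (multivariateGaussian m₁ S).withDensity
      (fun _ => 1) := withDensity_one.symm
  have hf1 : IsFiniteMeasure ((multivariateGaussian m₁ S).withDensity (fun _ => 1)) :=
    hone ▸ inferInstance
  have hf2 : IsFiniteMeasure ((multivariateGaussian m₁ S).withDensity
      (fun x => ENNReal.ofReal (Real.exp (inner ℝ x a - k)))) := hshift ▸ inferInstance
  have main := mapError_withDensity (ν := multivariateGaussian m₁ S) (p := fun _ => 1)
    (q := fun x => ENNReal.ofReal (Real.exp (inner ℝ x a - k)))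
    measurable_const (by fun_prop) (by simp) (by simp) (by simp)
  rw [← hone, ← hshift] at main
  rw [main]
  have hlt : ∀ x : EuclideanSpace ℝ κ,
      (1 : ℝ≥0∞) < ENNReal.ofReal (Real.exp (inner ℝ x a - k)) ↔ k < inner ℝ x a := fun x => by
    rw [ENNReal.one_lt_ofReal, Real.one_lt_exp_iff, sub_pos]
  have hle : ∀ x : EuclideanSpace ℝ κ,
      ENNReal.ofReal (Real.exp (inner ℝ x a - k)) ≤ 1 ↔ inner ℝ x a ≤ k := fun x => by
    rw [← not_lt, hlt, not_lt]
  simp only [hlt, hle]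
  have hm : Measurable fun x : EuclideanSpace ℝ κ => inner ℝ x a := by fun_prop
  have hs : 0 < √c := Real.sqrt_pos.2 hpos
  have std : ∀ (m : EuclideanSpace ℝ κ) (A : Set ℝ), MeasurableSet A →
      (multivariateGaussian m S).real ((fun x => inner ℝ x a) ⁻¹' A) =
      (gaussianReal 0 1).real ((fun z => inner ℝ m a + √c * z) ⁻¹' A) := by
    intro m A hA
    rw [measureReal_def, ← Measure.map_apply hm hA, map_inner_multivariateGaussian hS',
      measureReal_def, ← Measure.map_apply (by fun_prop) hA]
    congr 2
    have : (fun z => inner ℝ m a + √c * z) = (fun z => inner ℝ m a + z) ∘ (fun z => √c * z) := rfl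
    rw [this, ← Measure.map_map (by fun_prop) (by fun_prop), gaussianReal_map_const_mul,
      gaussianReal_map_const_add, hc]
    congr 1
    · simp
    · ext; simp [Real.sq_sqrt hc0, hc0]
  have e1 := std m₁ (Set.Ioi k) measurableSet_Ioi
  have e2 := std m₂ (Set.Iic k) measurableSet_Iic
  have hm2 : inner ℝ m₂ a = inner ℝ m₁ a + c := by
    have : inner ℝ (m₂ - m₁) a = c := by rw [inner_toLp_eq]
    rw [inner_sub_left] at this
    linarith
  have hkc : k = inner ℝ m₁ a + √c * √c / 2 := by
    rw [hk, hc, Real.mul_self_sqrt hc0]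
  have s1 : (fun z => inner ℝ m₁ a + √c * z) ⁻¹' (Set.Ioi k) = Set.Ioi ((1 / 2) * √c) := by
    ext z
    simp only [Set.mem_preimage, Set.mem_Ioi, hkc, add_lt_add_iff_left]
    rw [show √c * √c / 2 = √c * ((1 / 2) * √c) by ring, mul_lt_mul_iff_right₀ hs]
  have s2 : (fun z => inner ℝ m₂ a + √c * z) ⁻¹' (Set.Iic k) = Set.Iic (-((1 / 2) * √c)) := by
    ext z
    simp only [Set.mem_preimage, Set.mem_Iic, hkc, hm2]
    rw [← mul_le_mul_iff_right₀ hs]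
    have := Real.mul_self_sqrt hc0
    constructor <;> intro h <;> nlinarith
  rw [s1, gaussian_Ioi] at e1
  rw [s2, gaussianReal_symm_real] at e2
  have e1' : (multivariateGaussian m₁ S).real {x | k < inner ℝ x a} = _ := e1
  have e2' : (multivariateGaussian m₂ S).real {x | inner ℝ x a ≤ k} = _ := e2
  rw [e1', e2']
  ring

end Multivariate

/-! ### Scalar Gaussian laws with common mean -/

section Scalar

theorem log_gaussianPDFReal (c : ℝ) {v : ℝ≥0} (hv : v ≠ 0) (x : ℝ) :
    Real.log (gaussianPDFReal c v x) =
      -(1 / 2) * Real.log (2 * Real.pi) - (1 / 2) * Real.log v - (x - c) ^ 2 / (2 * v) := by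
  have hv' : (0 : ℝ) < v := by positivity
  rw [gaussianPDFReal_def]
  have h1 : (0 : ℝ) < √(2 * Real.pi * v) := by positivity
  rw [Real.log_mul (by positivity) (Real.exp_pos _).ne', Real.log_exp, Real.log_inv,
    Real.log_sqrt (by positivity), Real.log_mul (by positivity) hv'.ne']
  ring

theorem gaussianPDF_lt_iff (c : ℝ) {v₁ v₂ : ℝ≥0} (h₁ : v₁ ≠ 0) (h₂ : v₂ ≠ 0) (x : ℝ) :
    gaussianPDF c v₁ x < gaussianPDF c v₂ x ↔
      (x - c) ^ 2 * ((v₂ : ℝ)⁻¹ - (v₁ : ℝ)⁻¹) < Real.log (v₁ / v₂) := by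
  have hv₁ : (0 : ℝ) < v₁ := by positivity
  have hv₂ : (0 : ℝ) < v₂ := by positivity
  rw [gaussianPDF_def, gaussianPDF_def, ENNReal.ofReal_lt_ofReal_iff (gaussianPDFReal_pos _ _ _ h₂),
    ← Real.log_lt_log_iff (gaussianPDFReal_pos _ _ _ h₁) (gaussianPDFReal_pos _ _ _ h₂),
    log_gaussianPDFReal c h₁, log_gaussianPDFReal c h₂, Real.log_div hv₁.ne' hv₂.ne']
  have e : ∀ w : ℝ, (x - c) ^ 2 / (2 * w) = (x - c) ^ 2 * w⁻¹ / 2 := fun w => by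
    rw [mul_comm, ← div_div, div_eq_mul_inv ((x - c) ^ 2)]
  rw [e, e, mul_sub]
  constructor <;> intro h <;> linarith

theorem gaussianReal_real_preimage (c : ℝ) (v : ℝ≥0) {A : Set ℝ} (hA : MeasurableSet A) :
    (gaussianReal c v).real A = (gaussianReal 0 1).real {z | c + √v * z ∈ A} := by
  have h : (gaussianReal 0 1).map (fun z => c + √v * z) = gaussianReal c v := by
    have : (fun z => c + √v * z) = (fun z => c + z) ∘ (fun z => √v * z) := rfl
    rw [this, ← Measure.map_map (by fun_prop) (by fun_prop), gaussianReal_map_const_mul,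
      gaussianReal_map_const_add]
    congr 1
    · simp
    · ext; simp
  rw [measureReal_def, ← h, Measure.map_apply (by fun_prop) hA]
  rfl

/-- Comparing the densities amounts to a threshold on `(x - c)²`. Substituting `x = c + √v z` turns
it into the threshold `τ` on `z²` under the first law and `τ R` under the second. -/
theorem mapError_gaussianReal (c : ℝ) {v₁ v₂ : ℝ≥0} (h₂ : v₂ ≠ 0) (h : v₂ < v₁) :
    mapError (gaussianReal c v₁) (gaussianReal c v₂) =
      (1 / 2) * (1 - QChiSq (Real.log ((v₁ : ℝ) / v₂) / ((v₁ : ℝ) / v₂ - 1))) +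
        (1 / 2) * QChiSq (Real.log ((v₁ : ℝ) / v₂) / ((v₁ : ℝ) / v₂ - 1) * ((v₁ : ℝ) / v₂)) := by
  have h₁ : v₁ ≠ 0 := (lt_of_le_of_lt zero_le h).ne'
  have hv₁ : (0 : ℝ) < v₁ := by positivity
  have hv₂ : (0 : ℝ) < v₂ := by positivity
  have hv : (v₂ : ℝ) < v₁ := by exact_mod_cast h
  have f1 : IsFiniteMeasure (volume.withDensity (gaussianPDF c v₁)) := by
    rw [← gaussianReal_of_var_ne_zero c h₁]; infer_instance
  have f2 : IsFiniteMeasure (volume.withDensity (gaussianPDF c v₂)) := by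
    rw [← gaussianReal_of_var_ne_zero c h₂]; infer_instance
  have main := mapError_withDensity (ν := (volume : Measure ℝ)) (measurable_gaussianPDF c v₁)
    (measurable_gaussianPDF c v₂) (fun x => (gaussianPDF_pos c h₁ x).ne')
    (fun x => gaussianPDF_ne_top) (fun x => gaussianPDF_ne_top)
  rw [← gaussianReal_of_var_ne_zero c h₁, ← gaussianReal_of_var_ne_zero c h₂] at main
  rw [main, gaussianReal_real_preimage c v₁, gaussianReal_real_preimage c v₂]
  rotate_left
  · exact measurableSet_le (measurable_gaussianPDF c v₂) (measurable_gaussianPDF c v₁)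
  · exact measurableSet_lt (measurable_gaussianPDF c v₁) (measurable_gaussianPDF c v₂)
  set R : ℝ := (v₁ : ℝ) / v₂ with hR
  have hR1 : 0 < R - 1 := by rw [sub_pos, hR, one_lt_div hv₂]; exact hv
  have hR0 : 0 < R := by linarith
  have s1 : {z : ℝ | c + √(v₁ : ℝ) * z ∈ {x | gaussianPDF c v₁ x < gaussianPDF c v₂ x}} =
      {z : ℝ | Real.log R / (R - 1) ≤ z ^ 2}ᶜ := by
    ext z
    simp only [Set.mem_ofPred_eq, Set.mem_compl_iff, not_le]
    rw [gaussianPDF_lt_iff c h₁ h₂, lt_div_iff₀ hR1, ← hR, add_sub_cancel_left, mul_pow,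
      Real.sq_sqrt hv₁.le]
    have : (v₁ : ℝ) * z ^ 2 * ((v₂ : ℝ)⁻¹ - (v₁ : ℝ)⁻¹) = z ^ 2 * (R - 1) := by
      rw [hR]; field_simp
    rw [this]
  have s2 : {z : ℝ | c + √(v₂ : ℝ) * z ∈ {x | gaussianPDF c v₂ x ≤ gaussianPDF c v₁ x}} =
      {z : ℝ | Real.log R / (R - 1) * R ≤ z ^ 2} := by
    ext z
    simp only [Set.mem_ofPred_eq]
    rw [← not_lt, gaussianPDF_lt_iff c h₁ h₂, not_lt, div_mul_eq_mul_div, div_le_iff₀ hR1, ← hR,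
      add_sub_cancel_left, mul_pow, Real.sq_sqrt hv₂.le]
    have : (v₂ : ℝ) * z ^ 2 * ((v₂ : ℝ)⁻¹ - (v₁ : ℝ)⁻¹) = z ^ 2 * (R - 1) / R := by
      rw [hR]; field_simp
    rw [this, le_div_iff₀ hR0]
  rw [s1, s2, QChiSq_def, QChiSq_def, measureReal_compl (measurableSet_le (by fun_prop) (by fun_prop))]
  simp

theorem integral_sq_sub_mean_gaussianReal (c : ℝ) (v : ℝ≥0) :
    ∫ x, (x - c) ^ 2 ∂gaussianReal c v = v := by
  have h := variance_fun_id_gaussianReal (μ := c) (v := v)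
  rw [variance_eq_integral (by fun_prop)] at h
  simpa [integral_id_gaussianReal] using h

theorem integrable_sq_sub_mean_gaussianReal (c : ℝ) (v : ℝ≥0) :
    Integrable (fun x => (x - c) ^ 2) (gaussianReal c v) := by
  have h : MemLp (fun x : ℝ => x - c) 2 (gaussianReal c v) :=
    (memLp_id_gaussianReal (μ := c) (v := v) 2).sub (memLp_const c)
  exact h.integrable_sq

theorem llr_gaussianReal (c : ℝ) {v₁ v₂ : ℝ≥0} (h₁ : v₁ ≠ 0) (h₂ : v₂ ≠ 0) :
    llr (gaussianReal c v₁) (gaussianReal c v₂) =ᵐ[gaussianReal c v₁] fun x =>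
      (1 / 2) * (Real.log v₂ - Real.log v₁) +
        (1 / 2) * ((v₂ : ℝ)⁻¹ - (v₁ : ℝ)⁻¹) * (x - c) ^ 2 := by
  have e1 := Measure.rnDeriv_withDensity_right (gaussianReal c v₁) volume
    (measurable_gaussianPDF c v₂).aemeasurable
    (ae_of_all _ fun x => (gaussianPDF_pos c h₂ x).ne') (ae_of_all _ fun x => gaussianPDF_ne_top)
  rw [← gaussianReal_of_var_ne_zero c h₂] at e1
  have e2 := rnDeriv_gaussianReal c v₁
  have hac := gaussianReal_absolutelyContinuous c h₁
  filter_upwards [hac.ae_le e1, hac.ae_le e2] with x h1 h2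
  have p1 := gaussianPDFReal_pos c v₁ x h₁
  have p2 := gaussianPDFReal_pos c v₂ x h₂
  rw [llr_def]
  simp only
  rw [h1, h2, ENNReal.toReal_mul, ENNReal.toReal_inv, toReal_gaussianPDF, toReal_gaussianPDF,
    Real.log_mul (inv_ne_zero p2.ne') p1.ne', Real.log_inv, log_gaussianPDFReal c h₁,
    log_gaussianPDFReal c h₂]
  have e : ∀ w : ℝ, (x - c) ^ 2 / (2 * w) = (x - c) ^ 2 * w⁻¹ / 2 := fun w => by
    rw [mul_comm, ← div_div, div_eq_mul_inv ((x - c) ^ 2)]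
  rw [e, e]
  ring

theorem gaussianReal_ac (c : ℝ) {v₁ v₂ : ℝ≥0} (h₁ : v₁ ≠ 0) (h₂ : v₂ ≠ 0) :
    gaussianReal c v₁ ≪ gaussianReal c v₂ :=
  (gaussianReal_absolutelyContinuous c h₁).trans (gaussianReal_absolutelyContinuous' c h₂)

theorem klDiv_gaussianReal (c : ℝ) {v₁ v₂ : ℝ≥0} (h₁ : v₁ ≠ 0) (h₂ : v₂ ≠ 0) :
    klDiv (gaussianReal c v₁) (gaussianReal c v₂) ≠ ∞ ∧
    (klDiv (gaussianReal c v₁) (gaussianReal c v₂)).toReal =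
      (1 / 2) * (Real.log v₂ - Real.log v₁) + (1 / 2) * ((v₁ : ℝ) / v₂ - 1) := by
  have hac := gaussianReal_ac c h₁ h₂
  have hllr := llr_gaussianReal c h₁ h₂
  have hsq := (integrable_sq_sub_mean_gaussianReal c v₁).const_mul
    ((1 / 2) * ((v₂ : ℝ)⁻¹ - (v₁ : ℝ)⁻¹))
  refine ⟨klDiv_ne_top hac (((integrable_const _).add hsq).congr hllr.symm), ?_⟩
  rw [toReal_klDiv_of_measure_eq hac (by simp), integral_congr_ae hllr,
    integral_add (integrable_const _) hsq, integral_const_mul, integral_const_mul,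
    integral_sq_sub_mean_gaussianReal]
  have hv₁ : (v₁ : ℝ) ≠ 0 := by exact_mod_cast h₁
  simp only [integral_const, probReal_univ, smul_eq_mul, one_mul]
  field_simp

/-- The logarithms in the two divergences cancel, leaving `(v₁/v₂ + v₂/v₁ - 2) / 4`. -/
theorem symm_klDiv_gaussianReal (c : ℝ) {v₁ v₂ : ℝ≥0} (h : v₁ = 0 ↔ v₂ = 0) :
    (1 / 2) * klDiv (gaussianReal c v₁) (gaussianReal c v₂) +
      (1 / 2) * klDiv (gaussianReal c v₂) (gaussianReal c v₁) =
      ENNReal.ofReal (((v₁ : ℝ) - v₂) ^ 2 / (4 * (v₁ * v₂))) := by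
  -- If both variances vanish, both laws are the same Dirac mass and the right-hand side is `0 / 0 =
  -- 0`.
  by_cases h₁ : v₁ = 0
  · rw [h₁, h.1 h₁]; simp
  have h₂ : v₂ ≠ 0 := fun e => h₁ (h.2 e)
  obtain ⟨t1, k1⟩ := klDiv_gaussianReal c h₁ h₂
  obtain ⟨t2, k2⟩ := klDiv_gaussianReal c h₂ h₁
  have m1 := ENNReal.mul_ne_top (a := 1 / 2) (by simp) t1
  have m2 := ENNReal.mul_ne_top (a := 1 / 2) (by simp) t2
  rw [← ENNReal.ofReal_toReal (ENNReal.add_ne_top.2 ⟨m1, m2⟩), ENNReal.toReal_add m1 m2,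
    ENNReal.toReal_mul, ENNReal.toReal_mul, k1, k2]
  congr 1
  have hv₁ : (v₁ : ℝ) ≠ 0 := by exact_mod_cast h₁
  have hv₂ : (v₂ : ℝ) ≠ 0 := by exact_mod_cast h₂
  simp only [one_div, ENNReal.toReal_inv, ENNReal.toReal_ofNat]
  field_simp
  ring

end Scalar

/-! ### Block Toeplitz matrices -/

section Toeplitz

variable {m r q : ℕ}

/-- The block lower triangular Toeplitz matrix with blocks `T 0, T 1, …`. -/
def toepl (T : ℕ → Matrix (Fin m) (Fin r) ℝ) (N : ℕ) :
    Matrix (Fin N × Fin m) (Fin N × Fin r) ℝ :=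
  Matrix.of fun a c => if c.1 ≤ a.1 then T (a.1 - c.1) a.2 c.2 else 0

theorem toepl_mulVec (T : ℕ → Matrix (Fin m) (Fin r) ℝ) (N : ℕ) (x : Fin N × Fin r → ℝ)
    (k : Fin N) (a : Fin m) :
    (toepl T N *ᵥ x) (k, a) =
      ∑ j : Fin N, if j ≤ k then (T (k - j) *ᵥ fun c => x (j, c)) a else 0 := by
  simp only [Matrix.mulVec, dotProduct, toepl, Matrix.of_apply, Fintype.sum_prod_type]
  refine Finset.sum_congr rfl fun j _ => ?_
  split_ifs <;> simp

theorem toepl_transpose_mulVec (T : ℕ → Matrix (Fin m) (Fin r) ℝ) (N : ℕ)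
    (b : Fin N × Fin m → ℝ) (j : Fin N) (c : Fin r) :
    ((toepl T N)ᵀ *ᵥ b) (j, c) =
      ∑ k : Fin N, if j ≤ k then ((T (k - j))ᵀ *ᵥ fun a => b (k, a)) c else 0 := by
  simp only [Matrix.mulVec, dotProduct, toepl, Matrix.of_apply, Fintype.sum_prod_type,
    Matrix.transpose_apply]
  refine Finset.sum_congr rfl fun k _ => ?_
  split_ifs <;> simp

/-- Multiplying every block by `S` amounts to applying `S` in each time slot. This and the
transposed version move the normalisation `psdSqrt D` in and out of the Toeplitz matrix. -/
theorem toepl_mul_mulVec (T : ℕ → Matrix (Fin m) (Fin r) ℝ) (S : Matrix (Fin r) (Fin q) ℝ)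
    (N : ℕ) (x : Fin N × Fin q → ℝ) :
    toepl (fun k => T k * S) N *ᵥ x =
      toepl T N *ᵥ fun p => (S *ᵥ fun c => x (p.1, c)) p.2 := by
  ext ⟨k, a⟩
  rw [toepl_mulVec, toepl_mulVec]
  refine Finset.sum_congr rfl fun j _ => ?_
  rw [← Matrix.mulVec_mulVec]

theorem toepl_mul_transpose_mulVec (T : ℕ → Matrix (Fin m) (Fin r) ℝ)
    (S : Matrix (Fin r) (Fin q) ℝ) (N : ℕ) (b : Fin N × Fin m → ℝ) (j : Fin N) (c : Fin q) :
    ((toepl (fun k => T k * S) N)ᵀ *ᵥ b) (j, c) =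
      (Sᵀ *ᵥ fun c' => ((toepl T N)ᵀ *ᵥ b) (j, c')) c := by
  have h : (fun c' => ((toepl T N)ᵀ *ᵥ b) (j, c')) =
      ∑ k : Fin N, if j ≤ k then ((T (k - j))ᵀ *ᵥ fun a => b (k, a)) else 0 := by
    ext c'
    rw [toepl_transpose_mulVec, Finset.sum_apply]
    refine Finset.sum_congr rfl fun k _ => ?_
    split_ifs <;> rfl
  rw [toepl_transpose_mulVec, h, Matrix.mulVec_sum, Finset.sum_apply]
  refine Finset.sum_congr rfl fun k _ => ?_
  split_ifs
  · rw [Matrix.transpose_mul, Matrix.mulVec_mulVec]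
  · simp

end Toeplitz

/-! ### The law of the measurements -/

section Law

variable {n r m : ℕ}

/-- The impulse response `C G^k Π` of the network. -/
def impulse (G : Matrix (Fin n) (Fin n) ℝ) (K : Fin r ↪ Fin n) (J : Fin m ↪ Fin n) (k : ℕ) :
    Matrix (Fin m) (Fin r) ℝ :=
  (selection ℝ J)ᵀ * G ^ k * selection ℝ K

theorem state_eq_sum (G : Matrix (Fin n) (Fin n) ℝ) (K : Fin r ↪ Fin n)
    (w : ℕ → EuclideanSpace ℝ (Fin r)) (k : ℕ) :
    state G K w k = ∑ j ∈ Finset.range k, (G ^ (k - 1 - j) * selection ℝ K) *ᵥ (w j).ofLp := by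
  induction k with
  | zero => simp [state]
  | succ k ih =>
    rw [state, ih, Finset.sum_range_succ, Matrix.mulVec_sum]
    congr 1
    · refine Finset.sum_congr rfl fun j hj => ?_
      have : k + 1 - 1 - j = (k - 1 - j) + 1 := by have := Finset.mem_range.1 hj; omega
      rw [this, Matrix.mulVec_mulVec, pow_succ', Matrix.mul_assoc]
    · simp

/-- Index `k : Fin N` stands for time `k + 1`, and `y[k+1]` sees the inputs `w[0], …, w[k]`; hence
the diagonal blocks are present and the noise carries a shifted index. -/
theorem measurements_eq (G : Matrix (Fin n) (Fin n) ℝ) (K : Fin r ↪ Fin n)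
    (J : Fin m ↪ Fin n) (N : ℕ)
    (p : (ℕ → EuclideanSpace ℝ (Fin r)) × (ℕ → EuclideanSpace ℝ (Fin m))) (a : Fin N × Fin m) :
    measurements G K J N p a =
      (toepl (impulse G K J) N *ᵥ fun c => p.1 c.1 c.2) a + p.2 (a.1 + 1) a.2 := by
  obtain ⟨k, a⟩ := a
  simp only [measurements]
  congr 1
  rw [toepl_mulVec, state_eq_sum, Matrix.mulVec_sum, Finset.sum_apply, ← Finset.sum_filter]
  refine Finset.sum_bij' (fun j hj => ⟨j, by have := Finset.mem_range.1 hj; omega⟩)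
    (fun j _ => j.1) ?_ ?_ ?_ ?_ ?_
  · intro j hj
    simp only [Finset.mem_filter, Finset.mem_univ, true_and]
    exact Fin.mk_le_of_le_val (Nat.lt_succ_iff.1 (Finset.mem_range.1 hj))
  · intro j hj
    simp only [Finset.mem_filter, Finset.mem_univ, true_and] at hj
    exact Finset.mem_range.2 (Nat.lt_succ_iff.2 hj)
  · intros; rfl
  · intros; rfl
  · intro j hj
    rw [Matrix.mulVec_mulVec, impulse, ← Matrix.mul_assoc]
    rfl

theorem measurable_measurements (G : Matrix (Fin n) (Fin n) ℝ) (K : Fin r ↪ Fin n)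
    (J : Fin m ↪ Fin n) (N : ℕ) : Measurable (measurements G K J N) := by
  have : measurements G K J N = fun p => WithLp.toLp 2 fun a =>
      (toepl (impulse G K J) N *ᵥ fun c => p.1 c.1 c.2) a + p.2 (a.1 + 1) a.2 := by
    ext p a
    exact measurements_eq G K J N p a
  rw [this]
  simp only [Matrix.mulVec, dotProduct]
  fun_prop

/-- Distinct coordinates of a product measure are independent, so the characteristic function
factorises. The injection `e` covers both the inputs, read from time 0, and the noises, read from
time 1. -/
theorem integral_exp_sum_infinitePi {q N : ℕ} (μ : Measure (EuclideanSpace ℝ (Fin q)))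
    [IsProbabilityMeasure μ] {e : Fin N → ℕ} (he : Function.Injective e)
    (c : Fin N → EuclideanSpace ℝ (Fin q)) :
    ∫ w, Complex.exp ((∑ k, inner ℝ (w (e k)) (c k) : ℝ) * Complex.I)
        ∂(Measure.infinitePi fun _ : ℕ => μ) = ∏ k, charFun μ (c k) := by
  have hind : iIndepFun (fun (k : Fin N) (w : ℕ → EuclideanSpace ℝ (Fin q)) =>
      inner ℝ (w (e k)) (c k)) (Measure.infinitePi fun _ : ℕ => μ) := by
    have h1 := iIndepFun_infinitePi (P := fun _ : ℕ => μ)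
      (X := fun _ (x : EuclideanSpace ℝ (Fin q)) => x) (fun _ => measurable_id)
    exact (h1.precomp he).comp (fun k x => inner ℝ x (c k)) (fun k => by fun_prop)
  have hm : ∀ k, Measurable fun w : ℕ → EuclideanSpace ℝ (Fin q) => inner ℝ (w (e k)) (c k) :=
    fun k => by fun_prop
  have h := congrFun (iIndepFun.charFun_map_fun_sum_eq_prod (fun k => (hm k).aemeasurable) hind) 1
  rw [charFun_apply,
    integral_map (Finset.measurable_fun_sum _ fun k _ => hm k).aemeasurable (by fun_prop), Finset.prod_apply] at h
  simp only [RCLike.inner_apply, conj_trivial, one_mul] at h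
  rw [h]
  refine Finset.prod_congr rfl fun k _ => ?_
  rw [charFun_apply, integral_map (hm k).aemeasurable (by fun_prop), charFun_apply]
  simp only [RCLike.inner_apply, conj_trivial, one_mul]
  rw [← integral_map (φ := fun w : ℕ → EuclideanSpace ℝ (Fin q) => w (e k))
    (f := fun x => Complex.exp ((inner ℝ x (c k) : ℝ) * Complex.I))
    (measurable_pi_apply _).aemeasurable (by fun_prop), Measure.infinitePi_map_eval]

/-- The covariance matrix of the measurements, as a function of the input and noise levels. -/
noncomputable def obsCov (T : ℕ → Matrix (Fin m) (Fin r) ℝ) (N : ℕ) (σ σv : ℝ) :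
    Matrix (Fin N × Fin m) (Fin N × Fin m) ℝ :=
  σ ^ 2 • (toepl T N * (toepl T N)ᵀ) + σv ^ 2 • (1 : Matrix (Fin N × Fin m) (Fin N × Fin m) ℝ)

theorem dotProduct_obsCov (T : ℕ → Matrix (Fin m) (Fin r) ℝ) (N : ℕ) (σ σv : ℝ)
    (b : Fin N × Fin m → ℝ) :
    b ⬝ᵥ obsCov T N σ σv *ᵥ b =
      σ ^ 2 * (((toepl T N)ᵀ *ᵥ b) ⬝ᵥ ((toepl T N)ᵀ *ᵥ b)) + σv ^ 2 * (b ⬝ᵥ b) := by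
  rw [obsCov, Matrix.add_mulVec, Matrix.smul_mulVec, Matrix.smul_mulVec, Matrix.one_mulVec,
    dotProduct_add, dotProduct_smul, dotProduct_smul, ← Matrix.mulVec_mulVec,
    Matrix.dotProduct_mulVec, ← Matrix.mulVec_transpose]
  rfl

theorem dotProduct_self_nonneg' {ι : Type*} [Fintype ι] (v : ι → ℝ) : 0 ≤ v ⬝ᵥ v :=
  Finset.sum_nonneg fun i _ => mul_self_nonneg (v i)

theorem isHermitian_obsCov (T : ℕ → Matrix (Fin m) (Fin r) ℝ) (N : ℕ) (σ σv : ℝ) :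
    (obsCov T N σ σv).IsHermitian := by
  simp [Matrix.IsHermitian, obsCov]

theorem posSemidef_obsCov (T : ℕ → Matrix (Fin m) (Fin r) ℝ) (N : ℕ) (σ σv : ℝ) :
    (obsCov T N σ σv).PosSemidef := by
  refine Matrix.PosSemidef.of_dotProduct_mulVec_nonneg (isHermitian_obsCov T N σ σv) fun b => ?_
  rw [star_trivial, dotProduct_obsCov]
  have h1 := dotProduct_self_nonneg' ((toepl T N)ᵀ *ᵥ b)
  have h2 := dotProduct_self_nonneg' b
  positivity

theorem posDef_obsCov (T : ℕ → Matrix (Fin m) (Fin r) ℝ) (N : ℕ) (σ : ℝ) {σv : ℝ} (hσ : 0 < σv) :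
    (obsCov T N σ σv).PosDef := by
  refine Matrix.PosDef.of_dotProduct_mulVec_pos (isHermitian_obsCov T N σ σv) fun b hb => ?_
  rw [star_trivial, dotProduct_obsCov]
  have h1 := dotProduct_self_nonneg' ((toepl T N)ᵀ *ᵥ b)
  have h2 : 0 < b ⬝ᵥ b := lt_of_le_of_ne (dotProduct_self_nonneg' b)
    fun h => hb (dotProduct_self_eq_zero.1 h.symm)
  positivity

theorem psdSqrt_mul_self {D : Matrix (Fin r) (Fin r) ℝ} (hD : D.PosDef) :
    psdSqrt D * psdSqrt D = D := by
  open scoped MatrixOrder in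
  exact CFC.sqrt_mul_sqrt_self D hD.posSemidef.nonneg

theorem psdSqrt_transpose (D : Matrix (Fin r) (Fin r) ℝ) : (psdSqrt D)ᵀ = psdSqrt D := by
  open scoped MatrixOrder in
  have h : (psdSqrt D).PosSemidef := Matrix.nonneg_iff_posSemidef.1 (CFC.sqrt_nonneg D)
  simpa using h.isHermitian.eq

theorem isUnit_det_psdSqrt {D : Matrix (Fin r) (Fin r) ℝ} (hD : D.PosDef) :
    IsUnit (psdSqrt D).det := by
  have h : IsUnit D.det := (Matrix.isUnit_iff_isUnit_det _).1 hD.isUnit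
  rw [← psdSqrt_mul_self hD, Matrix.det_mul] at h
  exact isUnit_of_mul_isUnit_left h

/-- The impulse response of the network with normalised inputs. -/
noncomputable def nimpulse (G : Matrix (Fin n) (Fin n) ℝ) (K : Fin r ↪ Fin n)
    (J : Fin m ↪ Fin n) (D : Matrix (Fin r) (Fin r) ℝ) (k : ℕ) : Matrix (Fin m) (Fin r) ℝ :=
  impulse G K J k * psdSqrt D

instance isProbabilityMeasure_hypLaw (G : Matrix (Fin n) (Fin n) ℝ) (K : Fin r ↪ Fin n)
    (J : Fin m ↪ Fin n) (D : Matrix (Fin r) (Fin r) ℝ) (σv : ℝ) (N : ℕ) (μ σ : ℝ) :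
    IsProbabilityMeasure (hypLaw G K J D σv N μ σ) :=
  Measure.isProbabilityMeasure_map (measurable_measurements G K J N).aemeasurable

/-- Characteristic functions agree: pairing `Y` with `t` gives independent contributions `⟨w[j], (Hᵀ
t)_j⟩` and `⟨v[k+1], t_k⟩`. The quadratic forms in `D` become squared norms after applying the
symmetric root `psdSqrt D`, which is absorbed into `nimpulse`. -/
theorem hypLaw_eq (G : Matrix (Fin n) (Fin n) ℝ) (K : Fin r ↪ Fin n)
    (J : Fin m ↪ Fin n) {D : Matrix (Fin r) (Fin r) ℝ} (hD : D.PosDef) (σv : ℝ) (N : ℕ) (μ σ : ℝ) :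
    hypLaw G K J D σv N μ σ =
      multivariateGaussian (WithLp.toLp 2 (toepl (impulse G K J) N *ᵥ fun _ => μ))
        (obsCov (nimpulse G K J D) N σ σv) := by
  apply Measure.ext_of_charFun
  ext t
  have hS1 : (σ ^ 2 • D).PosSemidef := hD.posSemidef.smul (sq_nonneg σ)
  have hS2 : (σv ^ 2 • (1 : Matrix (Fin m) (Fin m) ℝ)).PosSemidef :=
    Matrix.PosSemidef.one.smul (sq_nonneg σv)
  set H := toepl (impulse G K J) N with hH
  set c : Fin N → EuclideanSpace ℝ (Fin r) := fun j => WithLp.toLp 2 fun a => (Hᵀ *ᵥ t.ofLp) (j, a)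
    with hc
  set d : Fin N → EuclideanSpace ℝ (Fin m) := fun j => WithLp.toLp 2 fun a => t (j, a) with hd
  have hinner : ∀ p : (ℕ → EuclideanSpace ℝ (Fin r)) × (ℕ → EuclideanSpace ℝ (Fin m)),
      inner ℝ (measurements G K J N p) t =
        (∑ j : Fin N, inner ℝ (p.1 j) (c j)) + ∑ k : Fin N, inner ℝ (p.2 (k + 1)) (d k) := by
    intro p
    have e : (measurements G K J N p).ofLp =
        (H *ᵥ fun c => p.1 c.1 c.2) + fun a => p.2 (a.1 + 1) a.2 := by
      ext a; exact measurements_eq G K J N p a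
    rw [inner_toLp_eq, e, add_dotProduct]
    congr 1
    · rw [dotProduct_comm, Matrix.dotProduct_mulVec, ← Matrix.mulVec_transpose, dotProduct_comm]
      simp only [dotProduct, Fintype.sum_prod_type, inner_toLp_eq, hc]
    · simp only [dotProduct, Fintype.sum_prod_type, inner_toLp_eq, hd]
  rw [charFun_apply, hypLaw, measurementLaw,
    integral_map (measurable_measurements G K J N).aemeasurable (by fun_prop)]
  simp_rw [hinner, Complex.ofReal_add, add_mul, Complex.exp_add]
  rw [integral_prod_mul
    (f := fun w : ℕ → EuclideanSpace ℝ (Fin r) =>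
      Complex.exp (((∑ j : Fin N, inner ℝ (w j) (c j) : ℝ) : ℂ) * Complex.I))
    (g := fun v : ℕ → EuclideanSpace ℝ (Fin m) =>
      Complex.exp (((∑ k : Fin N, inner ℝ (v (k + 1)) (d k) : ℝ) : ℂ) * Complex.I)),
    integral_exp_sum_infinitePi _ (e := fun k : Fin N => (k : ℕ)) Fin.val_injective,
    integral_exp_sum_infinitePi _ (e := fun k : Fin N => (k : ℕ) + 1)
      (fun i j h => Fin.ext (Nat.succ_injective h)),
    charFun_multivariateGaussian (posSemidef_obsCov _ _ _ _)]
  simp_rw [charFun_multivariateGaussian hS1, charFun_multivariateGaussian hS2]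
  rw [← Complex.exp_sum, ← Complex.exp_sum, ← Complex.exp_add]
  congr 1
  have hmean : inner ℝ t (WithLp.toLp 2 (H *ᵥ fun _ => μ)) =
      ∑ j, inner ℝ (c j) (WithLp.toLp 2 fun _ => μ) := by
    rw [inner_toLp_eq, Matrix.dotProduct_mulVec, ← Matrix.mulVec_transpose]
    simp only [dotProduct, Fintype.sum_prod_type, inner_toLp_eq, hc]
  have hvar : t.ofLp ⬝ᵥ obsCov (nimpulse G K J D) N σ σv *ᵥ t.ofLp =
      (∑ j, (c j).ofLp ⬝ᵥ (σ ^ 2 • D) *ᵥ (c j).ofLp) +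
        ∑ k, (d k).ofLp ⬝ᵥ (σv ^ 2 • (1 : Matrix (Fin m) (Fin m) ℝ)) *ᵥ (d k).ofLp := by
    rw [dotProduct_obsCov]
    simp only [Matrix.smul_mulVec, dotProduct_smul, smul_eq_mul, ← Finset.mul_sum,
      Matrix.one_mulVec]
    congr 2
    · have : ∀ j, (c j).ofLp ⬝ᵥ D *ᵥ (c j).ofLp =
          (psdSqrt D *ᵥ (c j).ofLp) ⬝ᵥ (psdSqrt D *ᵥ (c j).ofLp) := fun j => by
        conv_lhs => rw [← psdSqrt_mul_self hD, ← Matrix.mulVec_mulVec, Matrix.dotProduct_mulVec,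
          ← Matrix.mulVec_transpose, psdSqrt_transpose]
      simp_rw [this]
      have h2 : ∀ j a, ((toepl (nimpulse G K J D) N)ᵀ *ᵥ t.ofLp) (j, a) =
          (psdSqrt D *ᵥ (c j).ofLp) a := fun j a => by
        have := toepl_mul_transpose_mulVec (impulse G K J) (psdSqrt D) N t.ofLp j a
        rw [psdSqrt_transpose] at this
        exact this
      conv_lhs => rw [dotProduct, Fintype.sum_prod_type]
      simp_rw [h2]
      rfl
    · simp only [dotProduct, Fintype.sum_prod_type, hd]
  rw [hmean, hvar]
  simp only [Complex.ofReal_sum, Complex.ofReal_add, Finset.sum_sub_distrib, ← Finset.sum_mul,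
    inner_zero_right, Complex.ofReal_zero, zero_mul, zero_sub, Finset.sum_neg_distrib,
    ← Finset.sum_div]
  ring

theorem meanVec_multivariateGaussian {κ : Type*} [Fintype κ] [DecidableEq κ]
    (a : EuclideanSpace ℝ κ) (S : Matrix κ κ ℝ) :
    meanVec (multivariateGaussian a S) = a.ofLp := by
  ext i
  have h := (EuclideanSpace.proj (𝕜 := ℝ) i).integral_comp_comm
    (IsGaussian.integrable_fun_id (μ := multivariateGaussian a S))
  rw [integral_id_multivariateGaussian] at h
  exact h

theorem covMat_multivariateGaussian {κ : Type*} [Fintype κ] [DecidableEq κ]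
    (a : EuclideanSpace ℝ κ) {S : Matrix κ κ ℝ} (hS : S.PosSemidef) :
    covMat (multivariateGaussian a S) = S := by
  ext i j
  exact covariance_eval_multivariateGaussian hS i j

theorem discriminantLaw_multivariateGaussian {κ : Type*} [Fintype κ] [DecidableEq κ]
    (a b : EuclideanSpace ℝ κ) {S : Matrix κ κ ℝ} (hS : S.PosSemidef) :
    discriminantLaw (multivariateGaussian a S) b =
      gaussianReal (inner ℝ a b) (b.ofLp ⬝ᵥ S *ᵥ b.ofLp).toNNReal := by
  rw [← map_inner_multivariateGaussian hS]
  have h : (fun y : EuclideanSpace ℝ κ => ∑ a, b a * y a) = fun y => inner ℝ y b := by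
    ext y
    rw [inner_toLp_eq, dotProduct_comm]
    rfl
  rw [discriminantLaw, h]

end Law

/-! ### Block Toeplitz matrices on constant inputs -/

section ConstantInput

variable {m r : ℕ}

theorem sum_fin_ite_sub_le {M : Type*} [AddCommMonoid M] {N : ℕ} (k : Fin N) (f : ℕ → M) :
    (∑ j : Fin N, if j ≤ k then f (k - j) else 0) = ∑ l ∈ Finset.range (k + 1), f l := by
  rw [← Finset.sum_filter]
  refine Finset.sum_bij' (fun j _ => (k : ℕ) - j) (fun l hl => ⟨k - l, by omega⟩) ?_ ?_ ?_ ?_ ?_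
  · intro j _
    exact Finset.mem_range.2 (by omega)
  · intro l hl
    simp only [Finset.mem_filter, Finset.mem_univ, true_and, Fin.le_def]
    omega
  · intro j hj
    simp only [Finset.mem_filter, Finset.mem_univ, true_and, Fin.le_def] at hj
    ext
    simp only
    omega
  · intro l hl
    have := Finset.mem_range.1 hl
    simp only
    omega
  · intros; rfl

theorem sum_fin_ite_le_sub {M : Type*} [AddCommMonoid M] {N : ℕ} (j : Fin N) (f : ℕ → M) :
    (∑ k : Fin N, if j ≤ k then f (k - j) else 0) = ∑ l ∈ Finset.range (N - j), f l := by
  rw [← Finset.sum_filter]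
  refine Finset.sum_bij' (fun k _ => (k : ℕ) - j)
    (fun l hl => ⟨j + l, by have := Finset.mem_range.1 hl; omega⟩) ?_ ?_ ?_ ?_ ?_
  · intro k hk
    simp only [Finset.mem_filter, Finset.mem_univ, true_and, Fin.le_def] at hk
    exact Finset.mem_range.2 (by omega)
  · intro l hl
    simp only [Finset.mem_filter, Finset.mem_univ, true_and, Fin.le_def]
    omega
  · intro k hk
    simp only [Finset.mem_filter, Finset.mem_univ, true_and, Fin.le_def] at hk
    ext
    simp only
    omega
  · intro l hl
    simp only
    omega
  · intros; rfl

/-- Time reversal: the transposed Toeplitz matrix produces partial sums of length `N - j`, which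
this aligns with those of length `k + 1` from the forward one. -/
theorem sum_fin_sub {M : Type*} [AddCommMonoid M] (N : ℕ) (f : ℕ → M) :
    ∑ j : Fin N, f (N - j) = ∑ k ∈ Finset.range N, f (k + 1) := by
  rw [Fin.sum_univ_eq_sum_range (fun j => f (N - j)), ← Finset.sum_range_reflect]
  refine Finset.sum_congr rfl fun j hj => ?_
  have := Finset.mem_range.1 hj
  congr 1
  omega

/-- The partial sums `T 0 + … + T (k - 1)`. -/
def psum (T : ℕ → Matrix (Fin m) (Fin r) ℝ) (k : ℕ) : Matrix (Fin m) (Fin r) ℝ :=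
  ∑ l ∈ Finset.range k, T l

theorem toepl_mulVec_const (T : ℕ → Matrix (Fin m) (Fin r) ℝ) (N : ℕ) (x : Fin r → ℝ)
    (k : Fin N) (a : Fin m) :
    (toepl T N *ᵥ fun p => x p.2) (k, a) = (psum T (k + 1) *ᵥ x) a := by
  rw [toepl_mulVec, sum_fin_ite_sub_le k (fun l => (T l *ᵥ x) a), psum, Matrix.sum_mulVec,
    Finset.sum_apply]

theorem toepl_transpose_mulVec_const (T : ℕ → Matrix (Fin m) (Fin r) ℝ) (N : ℕ) (b : Fin m → ℝ)
    (j : Fin N) (c : Fin r) :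
    ((toepl T N)ᵀ *ᵥ fun p => b p.2) (j, c) = ((psum T (N - j))ᵀ *ᵥ b) c := by
  rw [toepl_transpose_mulVec, sum_fin_ite_le_sub j (fun l => ((T l)ᵀ *ᵥ b) c), psum,
    Matrix.transpose_sum, Matrix.sum_mulVec, Finset.sum_apply]

theorem abs_sum_sub_le_of_eventually_const {f : ℕ → ℝ} {κ : ℝ} {k₀ : ℕ}
    (h : ∀ k, k₀ ≤ k → f k = κ) (N : ℕ) :
    |∑ k ∈ Finset.range N, f (k + 1) - N * κ| ≤ ∑ k ∈ Finset.range k₀, |f (k + 1) - κ| := by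
  have e : ∑ k ∈ Finset.range N, f (k + 1) - N * κ = ∑ k ∈ Finset.range N, (f (k + 1) - κ) := by
    simp [Finset.sum_sub_distrib]
  rw [e]
  refine (Finset.abs_sum_le_sum_abs _ _).trans ?_
  have h2 : ∑ k ∈ Finset.range N, |f (k + 1) - κ| ≤
      ∑ k ∈ Finset.range (k₀ + N), |f (k + 1) - κ| :=
    Finset.sum_le_sum_of_subset_of_nonneg (Finset.range_mono (by omega)) fun _ _ _ => abs_nonneg _
  refine h2.trans (le_of_eq ?_)
  rw [Finset.sum_range_add, add_eq_left]
  exact Finset.sum_eq_zero fun k _ => by rw [h _ (by omega)]; simp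

theorem PosDef_mulVec_inv {κ : Type*} [Fintype κ] [DecidableEq κ] {S : Matrix κ κ ℝ}
    (hS : S.PosDef) (d : κ → ℝ) : S *ᵥ (S⁻¹ *ᵥ d) = d := by
  rw [Matrix.mulVec_mulVec, Matrix.mul_nonsing_inv _ ((Matrix.isUnit_iff_isUnit_det _).1 hS.isUnit),
    Matrix.one_mulVec]

/-- Completing the square: the gap is the `S`-form at `y - S⁻¹ d`. Any trial `y` thus bounds the
signal-to-noise ratio from below. -/
theorem two_mul_sub_le_quadratic_inv {κ : Type*} [Fintype κ] [DecidableEq κ] {S : Matrix κ κ ℝ}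
    (hS : S.PosDef) (d y : κ → ℝ) : 2 * (y ⬝ᵥ d) - y ⬝ᵥ S *ᵥ y ≤ d ⬝ᵥ S⁻¹ *ᵥ d := by
  set z := S⁻¹ *ᵥ d with hz
  have hSz : S *ᵥ z = d := PosDef_mulVec_inv hS d
  have h := PosSemidef_dotProduct_nonneg hS.posSemidef (y - z)
  have h2 : z ⬝ᵥ S *ᵥ y = y ⬝ᵥ d := by
    rw [Matrix.dotProduct_mulVec, ← Matrix.mulVec_transpose,
      show Sᵀ = S by simpa using hS.isHermitian.eq, hSz, dotProduct_comm]
  rw [Matrix.mulVec_sub, hSz, sub_dotProduct, dotProduct_sub, dotProduct_sub, h2,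
    dotProduct_comm z d] at h
  linarith

/-- The dual bound, for any splitting `u = x + (u - x)`. With `y = Σ⁻¹ A u` the left side is both
`yᵀ Σ y` and `x · Aᵀ y + A (u - x) · y`. Young's inequality with weights `σ` and `σᵥ` bounds twice
the latter by the right side plus the former. -/
theorem quadratic_inv_obsCov_le (T : ℕ → Matrix (Fin m) (Fin r) ℝ) (N : ℕ) {σ σv : ℝ}
    (hσ : 0 < σ) (hσv : 0 < σv) (u x : Fin N × Fin r → ℝ) :
    (toepl T N *ᵥ u) ⬝ᵥ (obsCov T N σ σv)⁻¹ *ᵥ (toepl T N *ᵥ u) ≤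
      (x ⬝ᵥ x) / σ ^ 2 +
        ((toepl T N *ᵥ (u - x)) ⬝ᵥ (toepl T N *ᵥ (u - x))) / σv ^ 2 := by
  set A := toepl T N with hA
  have hS := posDef_obsCov T N σ hσv
  set y := (obsCov T N σ σv)⁻¹ *ᵥ (A *ᵥ u) with hy
  have hSy : obsCov T N σ σv *ᵥ y = A *ᵥ u := PosDef_mulVec_inv hS _
  have e1 : (A *ᵥ u) ⬝ᵥ y = σ ^ 2 * ((Aᵀ *ᵥ y) ⬝ᵥ (Aᵀ *ᵥ y)) + σv ^ 2 * (y ⬝ᵥ y) := by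
    rw [← dotProduct_obsCov, hSy, dotProduct_comm]
  have e2 : (A *ᵥ u) ⬝ᵥ y = x ⬝ᵥ (Aᵀ *ᵥ y) + (A *ᵥ (u - x)) ⬝ᵥ y := by
    rw [Matrix.mulVec_sub, sub_dotProduct, Matrix.dotProduct_mulVec x, ← Matrix.mulVec_transpose,
      Matrix.transpose_transpose]
    ring
  have am : ∀ {ι : Type} [Fintype ι] (p q : ι → ℝ) {s : ℝ}, 0 < s →
      2 * (p ⬝ᵥ q) ≤ (p ⬝ᵥ p) / s ^ 2 + s ^ 2 * (q ⬝ᵥ q) := by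
    intro ι _ p q s hs
    have h := dotProduct_self_nonneg' (s⁻¹ • p - s • q)
    simp only [sub_dotProduct, dotProduct_sub, smul_dotProduct, dotProduct_smul, smul_eq_mul,
      dotProduct_comm q p] at h
    have h1 : s⁻¹ * s = 1 := inv_mul_cancel₀ hs.ne'
    have h2 : (p ⬝ᵥ p) / s ^ 2 = s⁻¹ * (s⁻¹ * (p ⬝ᵥ p)) := by field_simp
    have h3 : s⁻¹ * (s * (p ⬝ᵥ q)) = p ⬝ᵥ q := by rw [← mul_assoc, h1, one_mul]
    have h4 : s * (s⁻¹ * (p ⬝ᵥ q)) = p ⬝ᵥ q := by rw [← mul_assoc, mul_comm s, h1, one_mul]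
    rw [h2]
    linarith
  have a1 := am x (Aᵀ *ᵥ y) hσ
  have a2 := am (A *ᵥ (u - x)) y hσv
  linarith

/-- The trial vectors `ζ = L ω` and `χ = σ² Lᵀ L ω` are optimal for the stationary problem in which
every partial sum is `L`. There the lower and the upper bound both contribute exactly `κ` per time
step, so only the first `k₀` steps cause an error, uniformly in `N`. -/
theorem abs_quadratic_inv_obsCov_sub_le {T : ℕ → Matrix (Fin m) (Fin r) ℝ} {k₀ : ℕ}
    {L : Matrix (Fin m) (Fin r) ℝ} (hL : ∀ k, k₀ ≤ k → psum T k = L) {σ σv : ℝ}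
    (hσ : 0 < σ) (hσv : 0 < σv) {u ω : Fin r → ℝ}
    (hω : σ ^ 2 • (Lᵀ *ᵥ (L *ᵥ ω)) + σv ^ 2 • ω = u) :
    ∃ C : ℝ, ∀ N : ℕ, |(toepl T N *ᵥ fun p => u p.2) ⬝ᵥ
      (obsCov T N σ σv)⁻¹ *ᵥ (toepl T N *ᵥ fun p => u p.2) - N * ((L *ᵥ ω) ⬝ᵥ (L *ᵥ u))| ≤ C := by
  set ζ := L *ᵥ ω with hζ
  set χ := σ ^ 2 • (Lᵀ *ᵥ ζ) with hχ
  set κ := ζ ⬝ᵥ (L *ᵥ u) with hκ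
  have huχ : u - χ = σv ^ 2 • ω := by rw [← hω]; simp
  have hκ' : κ = σ ^ 2 * ((Lᵀ *ᵥ ζ) ⬝ᵥ (Lᵀ *ᵥ ζ)) + σv ^ 2 * (ζ ⬝ᵥ ζ) := by
    rw [hκ, ← hω, Matrix.mulVec_add, Matrix.mulVec_smul, Matrix.mulVec_smul, dotProduct_add,
      dotProduct_smul, dotProduct_smul, ← hζ, Matrix.dotProduct_mulVec, ← Matrix.mulVec_transpose]
    rfl
  set f : ℕ → ℝ := fun k => 2 * (ζ ⬝ᵥ (psum T k *ᵥ u)) -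
    (σ ^ 2 * (((psum T k)ᵀ *ᵥ ζ) ⬝ᵥ ((psum T k)ᵀ *ᵥ ζ)) + σv ^ 2 * (ζ ⬝ᵥ ζ)) with hf
  set g : ℕ → ℝ := fun k => (χ ⬝ᵥ χ) / σ ^ 2 +
    ((psum T k *ᵥ (u - χ)) ⬝ᵥ (psum T k *ᵥ (u - χ))) / σv ^ 2 with hg
  have hf' : ∀ k, k₀ ≤ k → f k = κ := fun k hk => by
    rw [hf]
    simp only [hL k hk]
    rw [← hκ, ← hκ']
    ring
  have hg' : ∀ k, k₀ ≤ k → g k = κ := fun k hk => by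
    rw [hg]
    simp only [hL k hk]
    rw [huχ, Matrix.mulVec_smul, ← hζ, hκ', hχ]
    simp only [smul_dotProduct, dotProduct_smul, smul_eq_mul]
    field_simp
  refine ⟨max (∑ k ∈ Finset.range k₀, |f (k + 1) - κ|) (∑ k ∈ Finset.range k₀, |g (k + 1) - κ|),
    fun N => ?_⟩
  have bf := abs_le.1 (abs_sum_sub_le_of_eventually_const hf' N)
  have bg := abs_le.1 (abs_sum_sub_le_of_eventually_const hg' N)
  have lower := two_mul_sub_le_quadratic_inv (posDef_obsCov T N σ hσv)
    (toepl T N *ᵥ fun p => u p.2) (fun p => ζ p.2)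
  have upper := quadratic_inv_obsCov_le T N hσ hσv (fun p => u p.2) (fun p => χ p.2)
  have el : 2 * ((fun p : Fin N × Fin m => ζ p.2) ⬝ᵥ (toepl T N *ᵥ fun p => u p.2)) -
      (fun p : Fin N × Fin m => ζ p.2) ⬝ᵥ obsCov T N σ σv *ᵥ (fun p => ζ p.2) =
      ∑ k ∈ Finset.range N, f (k + 1) := by
    rw [dotProduct_obsCov]
    have h1 : (fun p : Fin N × Fin m => ζ p.2) ⬝ᵥ (toepl T N *ᵥ fun p => u p.2) =
        ∑ k ∈ Finset.range N, ζ ⬝ᵥ (psum T (k + 1) *ᵥ u) := by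
      rw [← Fin.sum_univ_eq_sum_range (fun k => ζ ⬝ᵥ (psum T (k + 1) *ᵥ u)), dotProduct,
        Fintype.sum_prod_type]
      simp only [toepl_mulVec_const, dotProduct]
    have h2 : ((toepl T N)ᵀ *ᵥ fun p => ζ p.2) ⬝ᵥ ((toepl T N)ᵀ *ᵥ fun p => ζ p.2) =
        ∑ k ∈ Finset.range N, ((psum T (k + 1))ᵀ *ᵥ ζ) ⬝ᵥ ((psum T (k + 1))ᵀ *ᵥ ζ) := by
      rw [← sum_fin_sub N (fun k => ((psum T k)ᵀ *ᵥ ζ) ⬝ᵥ ((psum T k)ᵀ *ᵥ ζ)), dotProduct,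
        Fintype.sum_prod_type]
      simp only [toepl_transpose_mulVec_const, dotProduct]
    have h3 : (fun p : Fin N × Fin m => ζ p.2) ⬝ᵥ (fun p => ζ p.2) = N * (ζ ⬝ᵥ ζ) := by
      simp [dotProduct, Fintype.sum_prod_type]
    rw [h1, h2, h3, hf]
    simp only [Finset.sum_sub_distrib, Finset.sum_add_distrib, ← Finset.mul_sum,
      Finset.sum_const, Finset.card_range, nsmul_eq_mul]
  have eu : ((fun p : Fin N × Fin r => χ p.2) ⬝ᵥ (fun p => χ p.2)) / σ ^ 2 +
      ((toepl T N *ᵥ ((fun p => u p.2) - fun p => χ p.2)) ⬝ᵥ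
        (toepl T N *ᵥ ((fun p => u p.2) - fun p => χ p.2))) / σv ^ 2 =
      ∑ k ∈ Finset.range N, g (k + 1) := by
    have h0 : ((fun p : Fin N × Fin r => u p.2) - fun p => χ p.2) = fun p => (u - χ) p.2 := rfl
    have h1 : (toepl T N *ᵥ fun p => (u - χ) p.2) ⬝ᵥ (toepl T N *ᵥ fun p => (u - χ) p.2) =
        ∑ k ∈ Finset.range N, (psum T (k + 1) *ᵥ (u - χ)) ⬝ᵥ (psum T (k + 1) *ᵥ (u - χ)) := by
      rw [← Fin.sum_univ_eq_sum_range
        (fun k => (psum T (k + 1) *ᵥ (u - χ)) ⬝ᵥ (psum T (k + 1) *ᵥ (u - χ))), dotProduct,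
        Fintype.sum_prod_type]
      simp only [toepl_mulVec_const, dotProduct]
    have h3 : (fun p : Fin N × Fin r => χ p.2) ⬝ᵥ (fun p => χ p.2) = N * (χ ⬝ᵥ χ) := by
      simp [dotProduct, Fintype.sum_prod_type]
    rw [h0, h1, h3, hg]
    simp only [Finset.sum_add_distrib, ← Finset.sum_div, Finset.sum_const, Finset.card_range,
      nsmul_eq_mul]
  rw [el] at lower
  rw [eu] at upper
  rw [abs_le]
  have m1 := le_max_left (∑ k ∈ Finset.range k₀, |f (k + 1) - κ|)
    (∑ k ∈ Finset.range k₀, |g (k + 1) - κ|)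
  have m2 := le_max_right (∑ k ∈ Finset.range k₀, |f (k + 1) - κ|)
    (∑ k ∈ Finset.range k₀, |g (k + 1) - κ|)
  constructor <;> linarith [bf.1, bg.2]

end ConstantInput

/-! ### The mean shift model -/

section MeanShift

variable {n r m : ℕ}

/-- For nilpotent `G` the Neumann series of `(I - G)⁻¹` terminates. -/
theorem psum_nimpulse_of_nilpotent {G : Matrix (Fin n) (Fin n) ℝ} (K : Fin r ↪ Fin n)
    (J : Fin m ↪ Fin n) (D : Matrix (Fin r) (Fin r) ℝ) {k₀ : ℕ} (hk : G ^ k₀ = 0) {k : ℕ}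
    (h : k₀ ≤ k) : psum (nimpulse G K J D) k = transfer ℝ G K J 1 * psdSqrt D := by
  have hinv : ((1 : ℝ) • (1 : Matrix (Fin n) (Fin n) ℝ) - G.map (algebraMap ℝ ℝ))⁻¹ =
      ∑ l ∈ Finset.range k, G ^ l := by
    apply Matrix.inv_eq_right_inv
    have h0 : G ^ k = 0 := by rw [← Nat.sub_add_cancel h, pow_add, hk, mul_zero]
    have h1 : G.map (algebraMap ℝ ℝ) = G := by ext; simp
    rw [one_smul, h1, mul_neg_geom_sum, h0, sub_zero]
  rw [transfer, hinv, psum]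
  simp only [nimpulse, impulse, Matrix.mul_sum, Matrix.sum_mul]

theorem toepl_nimpulse_mulVec (G : Matrix (Fin n) (Fin n) ℝ) (K : Fin r ↪ Fin n)
    (J : Fin m ↪ Fin n) {D : Matrix (Fin r) (Fin r) ℝ} (hD : D.PosDef) (N : ℕ) (μ : ℝ) :
    (toepl (impulse G K J) N *ᵥ fun _ => μ) =
      μ • (toepl (nimpulse G K J D) N *ᵥ
        fun p => ((psdSqrt D)⁻¹ *ᵥ fun _ => (1 : ℝ)) p.2) := by
  have h := toepl_mul_mulVec (impulse G K J) (psdSqrt D) N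
    (fun p => ((psdSqrt D)⁻¹ *ᵥ fun _ => (1 : ℝ)) p.2)
  have h1 : psdSqrt D *ᵥ ((psdSqrt D)⁻¹ *ᵥ fun _ => (1 : ℝ)) = fun _ => 1 := by
    rw [Matrix.mulVec_mulVec, Matrix.mul_nonsing_inv _ (isUnit_det_psdSqrt hD), Matrix.one_mulVec]
  have h2 : (fun p : Fin N × Fin r => (psdSqrt D *ᵥ
      fun c => ((psdSqrt D)⁻¹ *ᵥ fun _ => (1 : ℝ)) c) p.2) = fun _ => 1 := by
    ext p
    exact congrFun h1 p.2
  rw [show toepl (nimpulse G K J D) N = toepl (fun k => impulse G K J k * psdSqrt D) N from rfl, h]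
  rw [show (fun p : Fin N × Fin r => (psdSqrt D *ᵥ
      fun c => ((psdSqrt D)⁻¹ *ᵥ fun _ => (1 : ℝ)) c) p.2) = fun _ => 1 from h2,
    ← Matrix.mulVec_smul]
  congr 1
  ext; simp

theorem etaSq_hypLaw (G : Matrix (Fin n) (Fin n) ℝ) (K : Fin r ↪ Fin n)
    (J : Fin m ↪ Fin n) {D : Matrix (Fin r) (Fin r) ℝ} (hD : D.PosDef) (σ σv : ℝ) (N : ℕ)
    (μ₁ μ₂ : ℝ) :
    etaSq (hypLaw G K J D σv N μ₁ σ) (hypLaw G K J D σv N μ₂ σ) =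
      (μ₂ - μ₁) ^ 2 * ((toepl (nimpulse G K J D) N *ᵥ
          fun p => ((psdSqrt D)⁻¹ *ᵥ fun _ => (1 : ℝ)) p.2) ⬝ᵥ
        (obsCov (nimpulse G K J D) N σ σv)⁻¹ *ᵥ (toepl (nimpulse G K J D) N *ᵥ
          fun p => ((psdSqrt D)⁻¹ *ᵥ fun _ => (1 : ℝ)) p.2)) := by
  rw [etaSq, hypLaw_eq G K J hD, hypLaw_eq G K J hD, meanVec_multivariateGaussian,
    meanVec_multivariateGaussian, covMat_multivariateGaussian _ (posSemidef_obsCov _ _ _ _),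
    toepl_nimpulse_mulVec G K J hD, toepl_nimpulse_mulVec G K J hD, ← sub_smul,
    smul_dotProduct, Matrix.mulVec_smul, dotProduct_smul]
  simp only [smul_eq_mul]
  ring

theorem mapError_hypLaw_mean (G : Matrix (Fin n) (Fin n) ℝ) (K : Fin r ↪ Fin n)
    (J : Fin m ↪ Fin n) {D : Matrix (Fin r) (Fin r) ℝ} (hD : D.PosDef) (σ : ℝ) {σv : ℝ}
    (hσv : 0 < σv) (N : ℕ) (μ₁ μ₂ : ℝ) :
    mapError (hypLaw G K J D σv N μ₁ σ) (hypLaw G K J D σv N μ₂ σ) =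
      QNormal ((1 / 2) * √(etaSq (hypLaw G K J D σv N μ₁ σ) (hypLaw G K J D σv N μ₂ σ))) := by
  rw [etaSq, hypLaw_eq G K J hD, hypLaw_eq G K J hD, meanVec_multivariateGaussian,
    meanVec_multivariateGaussian, covMat_multivariateGaussian _ (posSemidef_obsCov _ _ _ _),
    mapError_multivariateGaussian (posDef_obsCov _ _ _ hσv)]
  rfl

theorem exists_abs_etaSq_sub_le {G : Matrix (Fin n) (Fin n) ℝ} (K : Fin r ↪ Fin n)
    (J : Fin m ↪ Fin n) {D : Matrix (Fin r) (Fin r) ℝ} (hD : D.PosDef) {σ σv : ℝ}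
    (hσ : 0 < σ) (hσv : 0 < σv) (hG : ∃ k : ℕ, G ^ k = 0) :
    ∃ C : ℝ, ∀ (N : ℕ) (μ₁ μ₂ : ℝ),
      |etaSq (hypLaw G K J D σv N μ₁ σ) (hypLaw G K J D σv N μ₂ σ) -
        etaSqLim G K J D σ σv N (μ₂ - μ₁)| ≤ C * (μ₂ - μ₁) ^ 2 := by
  obtain ⟨k₀, hk⟩ := hG
  set L := transfer ℝ G K J 1 * psdSqrt D with hL
  set u := (psdSqrt D)⁻¹ *ᵥ (fun _ => (1 : ℝ)) with hu
  set W := σ ^ 2 • (Lᵀ * L) + σv ^ 2 • (1 : Matrix (Fin r) (Fin r) ℝ) with hW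
  have hWh : W.IsHermitian := by simp [Matrix.IsHermitian, hW]
  have hWp : W.PosDef := by
    refine Matrix.PosDef.of_dotProduct_mulVec_pos hWh fun b hb => ?_
    rw [star_trivial, hW, Matrix.add_mulVec, Matrix.smul_mulVec, Matrix.smul_mulVec,
      Matrix.one_mulVec, dotProduct_add, dotProduct_smul, dotProduct_smul, ← Matrix.mulVec_mulVec,
      Matrix.dotProduct_mulVec, ← Matrix.mulVec_transpose, Matrix.transpose_transpose]
    have h1 := dotProduct_self_nonneg' (L *ᵥ b)
    have h2 : 0 < b ⬝ᵥ b := lt_of_le_of_ne (dotProduct_self_nonneg' b)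
      fun h => hb (dotProduct_self_eq_zero.1 h.symm)
    simp only [smul_eq_mul]
    positivity
  -- The stationary optimality equation is `W ω = u`; symmetry of `W⁻¹` then rewrites the form in
  -- `etaSqLim` as `(L ω) · (L u)`.
  set ω := W⁻¹ *ᵥ u with hω
  have hWω : σ ^ 2 • (Lᵀ *ᵥ (L *ᵥ ω)) + σv ^ 2 • ω = u := by
    have h := PosDef_mulVec_inv hWp u
    rw [← hω, hW, Matrix.add_mulVec, Matrix.smul_mulVec, Matrix.smul_mulVec, Matrix.one_mulVec,
      ← Matrix.mulVec_mulVec] at h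
    exact h
  obtain ⟨C, hC⟩ := abs_quadratic_inv_obsCov_sub_le (T := nimpulse G K J D)
    (fun k h => psum_nimpulse_of_nilpotent K J D hk h) hσ hσv hWω
  refine ⟨C, fun N μ₁ μ₂ => ?_⟩
  have hlim : etaSqLim G K J D σ σv N (μ₂ - μ₁) =
      (μ₂ - μ₁) ^ 2 * (N * ((L *ᵥ ω) ⬝ᵥ (L *ᵥ u))) := by
    have h : u ⬝ᵥ (W⁻¹ * (Lᵀ * L)) *ᵥ u = (L *ᵥ ω) ⬝ᵥ (L *ᵥ u) := by
      have hWt : (W⁻¹)ᵀ = W⁻¹ := by simpa using hWh.inv.eq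
      rw [← Matrix.mulVec_mulVec, Matrix.dotProduct_mulVec, ← Matrix.mulVec_transpose, hWt, ← hω,
        ← Matrix.mulVec_mulVec, Matrix.dotProduct_mulVec, ← Matrix.mulVec_transpose,
        Matrix.transpose_transpose]
    rw [← h, etaSqLim]
    ring
  rw [etaSq_hypLaw G K J hD, hlim, ← mul_sub, abs_mul, abs_of_nonneg (sq_nonneg (μ₂ - μ₁)),
    mul_comm C]
  exact mul_le_mul_of_nonneg_left (hC N) (sq_nonneg _)

/-- Subadditivity of the square root. Since `√` is 0 on negative numbers, no sign condition is
needed. -/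
theorem abs_sqrt_sub_sqrt_le (x y : ℝ) : |√x - √y| ≤ √|x - y| := by
  wlog h : y ≤ x generalizing x y
  · rw [abs_sub_comm, abs_sub_comm x]
    exact this y x (not_le.1 h).le
  rw [abs_of_nonneg (sub_nonneg.2 (Real.sqrt_le_sqrt h)), abs_of_nonneg (sub_nonneg.2 h),
    sub_le_iff_le_add]
  apply Real.sqrt_le_iff.2 ⟨by positivity, ?_⟩
  have h1 := Real.sq_sqrt (sub_nonneg.2 h)
  have h2 : y ≤ √y ^ 2 := by
    rcases le_total 0 y with hy | hy
    · rw [Real.sq_sqrt hy]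
    · exact hy.trans (sq_nonneg _)
  nlinarith [Real.sqrt_nonneg (x - y), Real.sqrt_nonneg y]

/-- Neither sequence need converge or stay bounded, so continuity alone would not do: the Hölder
bound for `√` and the Lipschitz bound for `QNormal` are uniform. -/
theorem tendsto_QNormal_sqrt_sub {x y : ℕ → ℝ} (h : Tendsto (fun N => x N - y N) atTop (𝓝 0)) :
    Tendsto (fun N => QNormal ((1 / 2) * √(x N)) - QNormal ((1 / 2) * √(y N))) atTop (𝓝 0) := by
  have h1 : Tendsto (fun N => √|x N - y N|) atTop (𝓝 0) := by
    have := (Real.continuous_sqrt.comp continuous_abs).continuousAt.tendsto.comp h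
    simpa [Function.comp_def] using this
  refine squeeze_zero_norm (fun N => ?_) h1
  rw [Real.norm_eq_abs]
  refine (QNormal_lipschitz _ _).trans ?_
  rw [← mul_sub, abs_mul]
  have h2 := abs_sqrt_sub_sqrt_le (x N) (y N)
  have h3 := abs_nonneg (√(x N) - √(y N))
  rw [abs_of_nonneg (by norm_num : (0 : ℝ) ≤ 1 / 2)]
  linarith

end MeanShift

/-! ### Complex exponentials -/

section Exponentials

/-- The character `θ ↦ exp (i p θ)`. -/
noncomputable def expi (p : ℤ) (θ : ℝ) : ℂ := Complex.exp ((p : ℂ) * θ * Complex.I)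

theorem expi_add (p q : ℤ) (θ : ℝ) : expi (p + q) θ = expi p θ * expi q θ := by
  rw [expi, expi, expi, ← Complex.exp_add]
  congr 1
  push_cast
  ring

theorem norm_expi (p : ℤ) (θ : ℝ) : ‖expi p θ‖ = 1 := by
  rw [expi, show (p : ℂ) * θ * Complex.I = ((p * θ : ℝ) : ℂ) * Complex.I by push_cast; ring]
  exact Complex.norm_exp_ofReal_mul_I _

theorem conj_expi (p : ℤ) (θ : ℝ) : (starRingEnd ℂ) (expi p θ) = expi (-p) θ := by
  rw [expi, expi, ← Complex.exp_conj]
  congr 1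
  simp

@[fun_prop]
theorem continuous_expi (p : ℤ) : Continuous (expi p) := by
  unfold expi
  fun_prop

theorem integral_expi (p : ℤ) :
    ∫ θ in (0 : ℝ)..(2 * Real.pi), expi p θ = if p = 0 then (2 * Real.pi : ℂ) else 0 := by
  split_ifs with h
  · simp [expi, h]
  · have hp : (p : ℂ) * Complex.I ≠ 0 := mul_ne_zero (by exact_mod_cast h) Complex.I_ne_zero
    have e : ∀ θ : ℝ, expi p θ = Complex.exp ((p : ℂ) * Complex.I * θ) := fun θ => by
      rw [expi]; congr 1; ring
    simp_rw [e]
    rw [integral_exp_mul_complex hp]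
    have h1 : Complex.exp ((p : ℂ) * Complex.I * ((2 * Real.pi : ℝ) : ℂ)) = 1 := by
      rw [← Complex.exp_int_mul_two_pi_mul_I p]
      congr 1
      push_cast
      ring
    rw [h1]
    simp

/-- Parseval for trigonometric polynomials: injectivity of the frequencies leaves only the diagonal
terms of the expanded square. -/
theorem integral_norm_sq_sum_expi {ι : Type*} [Fintype ι] {f : ι → ℤ}
    (hf : Function.Injective f) (z : ι → ℝ) :
    ∫ θ in (0 : ℝ)..(2 * Real.pi), ‖∑ k, expi (f k) θ * z k‖ ^ 2 =
      2 * Real.pi * ∑ k, z k * z k := by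
  classical
  have hc : ∀ θ : ℝ, ((‖∑ k, expi (f k) θ * z k‖ ^ 2 : ℝ) : ℂ) =
      ∑ k, ∑ l, expi (f k - f l) θ * (z k * z l : ℝ) := fun θ => by
    rw [Complex.ofReal_pow, ← Complex.mul_conj', map_sum, Finset.sum_mul_sum]
    refine Finset.sum_congr rfl fun k _ => Finset.sum_congr rfl fun l _ => ?_
    rw [map_mul, conj_expi, Complex.conj_ofReal, sub_eq_add_neg, expi_add]
    push_cast
    ring
  have h : ((∫ θ in (0 : ℝ)..(2 * Real.pi), ‖∑ k, expi (f k) θ * z k‖ ^ 2 : ℝ) : ℂ) =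
      ((2 * Real.pi * ∑ k, z k * z k : ℝ) : ℂ) := by
    rw [← intervalIntegral.integral_ofReal]
    simp_rw [hc]
    rw [intervalIntegral.integral_finsetSum fun k _ => by
      apply Continuous.intervalIntegrable; fun_prop]
    have : ∀ k, ∫ θ in (0 : ℝ)..(2 * Real.pi), ∑ l, expi (f k - f l) θ * ((z k * z l : ℝ) : ℂ) =
        2 * Real.pi * (z k * z k : ℝ) := fun k => by
      rw [intervalIntegral.integral_finsetSum fun l _ => by
        apply Continuous.intervalIntegrable; fun_prop]
      simp_rw [intervalIntegral.integral_mul_const, integral_expi, sub_eq_zero]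
      rw [Finset.sum_eq_single k]
      · simp
      · intro l _ hl
        rw [if_neg fun e => hl (hf e).symm, zero_mul]
      · simp
    simp_rw [this]
    push_cast
    rw [Finset.mul_sum]
  exact_mod_cast h

end Exponentials

/-! ### The spectral norm -/

section SpectralNorm

open scoped Matrix.Norms.L2Operator

variable {m r : ℕ}

/-- Cauchy–Schwarz followed by the arithmetic–geometric mean inequality; squared norms, unlike a
product of norms, can be integrated by Parseval. -/
theorem norm_dotProduct_mulVec_le (M : Matrix (Fin m) (Fin r) ℂ) (y : Fin m → ℂ)
    (x : Fin r → ℂ) {g : ℝ} (hg : ‖M‖ ≤ g) :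
    ‖y ⬝ᵥ M *ᵥ x‖ ≤ g / 2 * (∑ a, ‖y a‖ ^ 2 + ∑ c, ‖x c‖ ^ 2) := by
  set Y : EuclideanSpace ℂ (Fin m) := WithLp.toLp 2 (star y)
  set X : EuclideanSpace ℂ (Fin r) := WithLp.toLp 2 x
  set Z : EuclideanSpace ℂ (Fin m) := WithLp.toLp 2 (M *ᵥ x)
  have h1 : y ⬝ᵥ M *ᵥ x = inner ℂ Y Z := by
    rw [EuclideanSpace.inner_eq_star_dotProduct, dotProduct_comm]
    simp [Y, Z]
  have h2 : ‖Z‖ ≤ ‖M‖ * ‖X‖ := Matrix.l2_opNorm_mulVec M X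
  have h3 : ‖Y‖ ^ 2 = ∑ a, ‖y a‖ ^ 2 := by
    rw [EuclideanSpace.norm_sq_eq]; simp [Y]
  have h4 : ‖X‖ ^ 2 = ∑ a, ‖x a‖ ^ 2 := by
    rw [EuclideanSpace.norm_sq_eq]
  rw [h1, ← h3, ← h4]
  have hg0 : 0 ≤ g := (norm_nonneg M).trans hg
  calc ‖inner ℂ Y Z‖ ≤ ‖Y‖ * ‖Z‖ := norm_inner_le_norm _ _
    _ ≤ ‖Y‖ * (g * ‖X‖) := by gcongr; exact h2.trans (by gcongr)
    _ ≤ g / 2 * (‖Y‖ ^ 2 + ‖X‖ ^ 2) := by nlinarith [mul_nonneg hg0 (sq_nonneg (‖Y‖ - ‖X‖))]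

theorem norm_le_sqrt_of_conjTranspose (M : Matrix (Fin m) (Fin r) ℂ) {c : ℝ}
    (h : ∀ q : Fin m → ℂ, ∑ i, ‖(Mᴴ *ᵥ q) i‖ ^ 2 ≤ c * ∑ a, ‖q a‖ ^ 2) : ‖M‖ ≤ √c := by
  rw [← Matrix.l2_opNorm_conjTranspose, Matrix.l2_opNorm_def]
  refine ContinuousLinearMap.opNorm_le_bound _ (Real.sqrt_nonneg c) fun q => ?_
  have h1 := h q.ofLp
  rcases le_total 0 c with hc | hc
  · have e : ‖(WithLp.toLp 2 (Mᴴ *ᵥ q.ofLp) : EuclideanSpace ℂ (Fin r))‖ ≤ √c * ‖q‖ := by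
      rw [← EuclideanSpace.norm_sq_eq q] at h1
      rw [← Real.sqrt_sq (norm_nonneg q), ← Real.sqrt_mul hc]
      apply Real.le_sqrt_of_sq_le
      rw [EuclideanSpace.norm_sq_eq]
      exact h1
    exact e
  · have e : ‖(WithLp.toLp 2 (Mᴴ *ᵥ q.ofLp) : EuclideanSpace ℂ (Fin r))‖ ≤ √c * ‖q‖ := by
      rw [← EuclideanSpace.norm_sq_eq q] at h1
      have h2 : ‖(WithLp.toLp 2 (Mᴴ *ᵥ q.ofLp) : EuclideanSpace ℂ (Fin r))‖ ^ 2 ≤ 0 := by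
        rw [EuclideanSpace.norm_sq_eq]
        exact h1.trans (mul_nonpos_of_nonpos_of_nonneg hc (sq_nonneg _))
      have h3 := pow_eq_zero_iff (two_ne_zero) |>.1 (le_antisymm h2 (sq_nonneg _))
      rw [h3]
      positivity
    exact e

theorem norm_entry_le (M : Matrix (Fin m) (Fin r) ℂ) (a : Fin m) (c : Fin r) : ‖M a c‖ ≤ ‖M‖ := by
  have h := Matrix.l2_opNorm_mulVec M (EuclideanSpace.single c 1)
  have h2 := PiLp.norm_apply_le (p := 2)
    (WithLp.toLp 2 (M *ᵥ (EuclideanSpace.single c (1 : ℂ)).ofLp) : EuclideanSpace ℂ (Fin m)) a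
  simp only [PiLp.norm_single, norm_one, mul_one] at h
  refine le_trans ?_ (h2.trans h)
  simp

end SpectralNorm

/-! ### Toeplitz matrices and their symbol -/

section Symbol

open scoped Matrix.Norms.L2Operator

variable {m r : ℕ} {T : ℕ → Matrix (Fin m) (Fin r) ℝ} {F : ℝ → Matrix (Fin m) (Fin r) ℂ}

theorem hasSum_shift (hF : ∀ θ a c, HasSum (fun k : ℕ => expi (-(k + 1)) θ * (T k a c : ℂ)) (F θ a c))
    (p : ℤ) (θ : ℝ) (a : Fin m) (c : Fin r) :
    HasSum (fun l : ℕ => expi (p - l) θ * (T l a c : ℂ)) (expi (p + 1) θ * F θ a c) := by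
  have := (hF θ a c).mul_left (expi (p + 1) θ)
  have e : ∀ l : ℕ, expi (p - l) θ = expi (p + 1) θ * expi (-(l + 1)) θ := fun l => by
    rw [← expi_add]
    congr 1
    ring
  simp_rw [e, mul_assoc]
  exact this

theorem continuous_symbol (hs : ∀ a c, Summable fun k => |T k a c|)
    (hF : ∀ θ a c, HasSum (fun k : ℕ => expi (-(k + 1)) θ * (T k a c : ℂ)) (F θ a c))
    (a : Fin m) (c : Fin r) : Continuous fun θ => F θ a c := by
  have e : (fun θ => F θ a c) = fun θ => ∑' k : ℕ, expi (-(k + 1)) θ * (T k a c : ℂ) := by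
    ext θ; exact (hF θ a c).tsum_eq.symm
  rw [e]
  refine continuous_tsum (fun k => by fun_prop) (hs a c) fun k θ => ?_
  rw [norm_mul, norm_expi, one_mul, Complex.norm_real, Real.norm_eq_abs]

/-- The Fourier coefficients of the symbol are the Toeplitz blocks. The frequency shift by 1
compensates the leading `z⁻¹` of the resolvent, and the vanishing for `j > k` is causality. -/
theorem integral_expi_mul_symbol (hs : ∀ a c, Summable fun k => |T k a c|)
    (hF : ∀ θ a c, HasSum (fun k : ℕ => expi (-(k + 1)) θ * (T k a c : ℂ)) (F θ a c))
    (k j : ℕ) (a : Fin m) (c : Fin r) :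
    ∫ θ in (0 : ℝ)..(2 * Real.pi), expi (((k : ℤ) - j) + 1) θ * F θ a c =
      if j ≤ k then 2 * Real.pi * (T (k - j) a c : ℂ) else 0 := by
  have h := intervalIntegral.hasSum_integral_of_dominated_convergence (μ := volume)
    (a := 0) (b := 2 * Real.pi)
    (F := fun (l : ℕ) θ => expi (((k : ℤ) - j) - l) θ * (T l a c : ℂ))
    (f := fun θ => expi (((k : ℤ) - j) + 1) θ * F θ a c)
    (fun l _ => |T l a c|)
    (fun l => Continuous.aestronglyMeasurable (by fun_prop))
    (fun l => ae_of_all _ fun θ _ => by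
      rw [norm_mul, norm_expi, one_mul, Complex.norm_real, Real.norm_eq_abs])
    (ae_of_all _ fun θ _ => hs a c) (by simp)
    (ae_of_all _ fun θ _ => hasSum_shift hF _ θ a c)
  simp_rw [intervalIntegral.integral_mul_const, integral_expi] at h
  rw [← h.tsum_eq]
  split_ifs with hkj
  · rw [tsum_eq_single (k - j)]
    · rw [if_pos (by omega)]
    · intro l hl
      rw [if_neg (by omega), zero_mul]
  · have : ∀ l : ℕ, (if (k : ℤ) - j - l = 0 then (2 * Real.pi : ℂ) else 0) * (T l a c : ℂ) = 0 :=
      fun l => by rw [if_neg (by omega), zero_mul]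
    simp_rw [this]
    simp

theorem sum_comm_four {ι₁ ι₂ ι₃ ι₄ M : Type*} [Fintype ι₁] [Fintype ι₂] [Fintype ι₃] [Fintype ι₄]
    [AddCommMonoid M] (f : ι₁ → ι₂ → ι₃ → ι₄ → M) :
    ∑ a, ∑ c, ∑ k, ∑ j, f a c k j = ∑ k, ∑ a, ∑ j, ∑ c, f a c k j :=
  calc ∑ a, ∑ c, ∑ k, ∑ j, f a c k j = ∑ a, ∑ k, ∑ c, ∑ j, f a c k j :=
        Finset.sum_congr rfl fun _ _ => Finset.sum_comm
    _ = ∑ k, ∑ a, ∑ c, ∑ j, f a c k j := Finset.sum_comm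
    _ = _ := Finset.sum_congr rfl fun _ _ => Finset.sum_congr rfl fun _ _ => Finset.sum_comm

/-- The form `2π bᵀ A x` is the integral over the circle of `B(θ) · F(θ) X(θ)`, with `B` and `X`
trigonometric polynomials having coefficients `b` and `x`. The integrand is bounded pointwise
through `‖F‖ ≤ g`, and the integral of the bound is given by Parseval. -/
theorem toepl_bilinear_le (hs : ∀ a c, Summable fun k => |T k a c|)
    (hF : ∀ θ a c, HasSum (fun k : ℕ => expi (-(k + 1)) θ * (T k a c : ℂ)) (F θ a c))
    {g : ℝ} (hg : ∀ᵐ θ ∂(volume.restrict (Set.Icc 0 (2 * Real.pi))), ‖F θ‖ ≤ g) (N : ℕ)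
    (b : Fin N × Fin m → ℝ) (x : Fin N × Fin r → ℝ) :
    b ⬝ᵥ toepl T N *ᵥ x ≤ g / 2 * (b ⬝ᵥ b + x ⬝ᵥ x) := by
  have hpi : (0 : ℝ) < 2 * Real.pi := by positivity
  set B : ℝ → Fin m → ℂ := fun θ a => ∑ k : Fin N, expi ((k : ℕ) + 1) θ * b (k, a) with hB
  set X : ℝ → Fin r → ℂ := fun θ c => ∑ j : Fin N, expi (-(j : ℕ)) θ * x (j, c) with hX
  have hFc := continuous_symbol hs hF
  have hexp : ∀ θ, B θ ⬝ᵥ F θ *ᵥ X θ = ∑ a, ∑ c, ∑ k : Fin N, ∑ j : Fin N,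
      (expi ((((k : ℕ) : ℤ) - (j : ℕ)) + 1) θ * F θ a c) * (b (k, a) * x (j, c) : ℝ) := by
    intro θ
    simp only [dotProduct, Matrix.mulVec, hB, hX, Finset.mul_sum, Finset.sum_mul]
    refine Finset.sum_congr rfl fun a _ => ?_
    refine Finset.sum_congr rfl fun c _ => ?_
    rw [Finset.sum_comm]
    refine Finset.sum_congr rfl fun k _ => Finset.sum_congr rfl fun j _ => ?_
    rw [show (((k : ℕ) : ℤ) - (j : ℕ)) + 1 = (((k : ℕ) : ℤ) + 1) + (-((j : ℕ) : ℤ)) by ring,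
      expi_add (((k : ℕ) : ℤ) + 1)]
    push_cast
    ring
  have hint : ∫ θ in (0 : ℝ)..(2 * Real.pi), B θ ⬝ᵥ F θ *ᵥ X θ =
      ((2 * Real.pi * (b ⬝ᵥ toepl T N *ᵥ x) : ℝ) : ℂ) := by
    simp_rw [hexp]
    rw [intervalIntegral.integral_finsetSum fun a _ => by
      apply Continuous.intervalIntegrable; fun_prop]
    have h1 : ∀ a, ∫ θ in (0 : ℝ)..(2 * Real.pi), ∑ c, ∑ k : Fin N, ∑ j : Fin N,
        (expi ((((k : ℕ) : ℤ) - (j : ℕ)) + 1) θ * F θ a c) * ((b (k, a) * x (j, c) : ℝ) : ℂ) =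
        ∑ c, ∑ k : Fin N, ∑ j : Fin N,
          (if j ≤ k then 2 * Real.pi * (T (k - j) a c : ℂ) else 0) *
            ((b (k, a) * x (j, c) : ℝ) : ℂ) := by
      intro a
      rw [intervalIntegral.integral_finsetSum fun c _ => by
        apply Continuous.intervalIntegrable; fun_prop]
      refine Finset.sum_congr rfl fun c _ => ?_
      rw [intervalIntegral.integral_finsetSum fun k _ => by
        apply Continuous.intervalIntegrable; fun_prop]
      refine Finset.sum_congr rfl fun k _ => ?_
      rw [intervalIntegral.integral_finsetSum fun j _ => by
        apply Continuous.intervalIntegrable; fun_prop]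
      refine Finset.sum_congr rfl fun j _ => ?_
      rw [intervalIntegral.integral_mul_const, integral_expi_mul_symbol hs hF]
      rfl
    simp_rw [h1]
    rw [sum_comm_four]
    simp only [dotProduct, Matrix.mulVec, toepl, Matrix.of_apply, Fintype.sum_prod_type,
      Finset.mul_sum, Complex.ofReal_sum]
    refine Finset.sum_congr rfl fun k _ => Finset.sum_congr rfl fun a _ =>
      Finset.sum_congr rfl fun j _ => Finset.sum_congr rfl fun c _ => ?_
    split_ifs
    · push_cast; ring
    · simp
  have hBP : ∀ a, ∫ θ in (0 : ℝ)..(2 * Real.pi), ‖B θ a‖ ^ 2 =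
      2 * Real.pi * ∑ k : Fin N, b (k, a) * b (k, a) := fun a =>
    integral_norm_sq_sum_expi (f := fun k : Fin N => ((k : ℕ) : ℤ) + 1)
      (fun i j h => Fin.ext (by simpa using h)) fun k => b (k, a)
  have hXP : ∀ c, ∫ θ in (0 : ℝ)..(2 * Real.pi), ‖X θ c‖ ^ 2 =
      2 * Real.pi * ∑ j : Fin N, x (j, c) * x (j, c) := fun c =>
    integral_norm_sq_sum_expi (f := fun j : Fin N => -((j : ℕ) : ℤ))
      (fun i j h => Fin.ext (by simpa using h)) fun j => x (j, c)
  have hBc : ∀ a, Continuous fun θ => B θ a := fun a => by simp only [hB]; fun_prop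
  have hXc : ∀ a, Continuous fun θ => X θ a := fun a => by simp only [hX]; fun_prop
  have hbound : ‖∫ θ in (0 : ℝ)..(2 * Real.pi), B θ ⬝ᵥ F θ *ᵥ X θ‖ ≤
      ∫ θ in (0 : ℝ)..(2 * Real.pi), g / 2 * (∑ a, ‖B θ a‖ ^ 2 + ∑ c, ‖X θ c‖ ^ 2) := by
    refine intervalIntegral.norm_integral_le_of_norm_le hpi.le ?_
      (Continuous.intervalIntegrable (by fun_prop) _ _)
    have := (ae_restrict_iff' measurableSet_Icc).1 hg
    filter_upwards [this] with θ hθ hmem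
    exact norm_dotProduct_mulVec_le _ _ _ (hθ (Set.Ioc_subset_Icc_self hmem))
  have hval : ∫ θ in (0 : ℝ)..(2 * Real.pi), g / 2 * (∑ a, ‖B θ a‖ ^ 2 + ∑ c, ‖X θ c‖ ^ 2) =
      2 * Real.pi * (g / 2 * (b ⬝ᵥ b + x ⬝ᵥ x)) := by
    rw [intervalIntegral.integral_const_mul, intervalIntegral.integral_add
      (Continuous.intervalIntegrable (by fun_prop) _ _)
      (Continuous.intervalIntegrable (by fun_prop) _ _),
      intervalIntegral.integral_finsetSum fun a _ => by
        apply Continuous.intervalIntegrable; fun_prop,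
      intervalIntegral.integral_finsetSum fun a _ => by
        apply Continuous.intervalIntegrable; fun_prop]
    simp_rw [hBP, hXP, ← Finset.mul_sum]
    have e1 : b ⬝ᵥ b = ∑ a, ∑ k : Fin N, b (k, a) * b (k, a) := by
      rw [dotProduct, Fintype.sum_prod_type, Finset.sum_comm]
    have e2 : x ⬝ᵥ x = ∑ a, ∑ k : Fin N, x (k, a) * x (k, a) := by
      rw [dotProduct, Fintype.sum_prod_type, Finset.sum_comm]
    rw [e1, e2]
    ring
  rw [hint, hval, Complex.norm_real, Real.norm_eq_abs] at hbound
  have h2 := (le_abs_self _).trans hbound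
  exact le_of_mul_le_mul_left h2 hpi

theorem toepl_transpose_sq_le (hs : ∀ a c, Summable fun k => |T k a c|)
    (hF : ∀ θ a c, HasSum (fun k : ℕ => expi (-(k + 1)) θ * (T k a c : ℂ)) (F θ a c))
    {g : ℝ} (hg0 : 0 ≤ g)
    (hg : ∀ᵐ θ ∂(volume.restrict (Set.Icc 0 (2 * Real.pi))), ‖F θ‖ ≤ g) (N : ℕ)
    (b : Fin N × Fin m → ℝ) :
    ((toepl T N)ᵀ *ᵥ b) ⬝ᵥ ((toepl T N)ᵀ *ᵥ b) ≤ g ^ 2 * (b ⬝ᵥ b) := by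
  set x := (toepl T N)ᵀ *ᵥ b with hx
  -- Scaling `b` by `g` balances the two squares and yields `g |x|² ≤ g · g² |b|²`. For `g = 0` this
  -- is void, and the unscaled inequality is used instead.
  have h := toepl_bilinear_le hs hF hg N (g • b) x
  have e : b ⬝ᵥ toepl T N *ᵥ x = x ⬝ᵥ x := by
    rw [Matrix.dotProduct_mulVec, ← Matrix.mulVec_transpose]
  simp only [smul_dotProduct, dotProduct_smul, smul_eq_mul] at h
  rw [e] at h
  rcases hg0.eq_or_lt with h0 | hpos
  · have h' := toepl_bilinear_le hs hF hg N b x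
    rw [← h0, e] at h'
    rw [← h0]
    linarith
  · have h3 : g * (x ⬝ᵥ x) ≤ g * (g ^ 2 * (b ⬝ᵥ b)) := by nlinarith
    exact le_of_mul_le_mul_left h3 hpos

/-- For the plane wave `z(k, a) = e^{ikθ} q_a`, slot `j` of `Aᵀ z` is `e^{ijθ} V(N - j)`, and `V(M)`
tends to `e^{-iθ} F(θ)ᴴ q`. Thus `|Aᵀ z|² / N` is a Cesàro mean converging to `|F(θ)ᴴ q|²`, while
`|z|² / N = |q|²`. As the means converge, the bound is needed only for infinitely many `N`. -/
theorem symbol_norm_le_of_frequently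
    (hF : ∀ θ a c, HasSum (fun k : ℕ => expi (-(k + 1)) θ * (T k a c : ℂ)) (F θ a c)) {γ : ℝ}
    (h : ∃ᶠ N : ℕ in atTop, ∀ b : Fin N × Fin m → ℝ,
      ((toepl T N)ᵀ *ᵥ b) ⬝ᵥ ((toepl T N)ᵀ *ᵥ b) ≤ γ * (b ⬝ᵥ b)) (θ : ℝ) : ‖F θ‖ ≤ √γ := by
  apply norm_le_sqrt_of_conjTranspose
  intro q
  set V : ℕ → Fin r → ℂ := fun M c => ∑ l ∈ Finset.range M, expi l θ * ∑ a, (T l a c : ℂ) * q a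
    with hV
  set s : ℕ → ℝ := fun M => ∑ c, ‖V M c‖ ^ 2 with hsdef
  have hVlim : ∀ c, Tendsto (fun M => V M c) atTop (𝓝 (expi (-1) θ * ((F θ)ᴴ *ᵥ q) c)) := by
    intro c
    have h1 : ∀ a, HasSum (fun l : ℕ => expi l θ * ((T l a c : ℂ) * q a))
        (expi (-1) θ * (star (F θ a c) * q a)) := fun a => by
      have h2 := ((Complex.hasSum_conj'.2 (hF θ a c)).mul_left (expi (-1) θ)).mul_right (q a)
      simp only [map_mul, conj_expi, Complex.conj_ofReal] at h2
      have e : (fun l : ℕ => expi l θ * ((T l a c : ℂ) * q a)) =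
          fun l : ℕ => expi (-1) θ * (expi (- -((l : ℤ) + 1)) θ * (T l a c : ℂ)) * q a := by
        ext l
        have := expi_add (-1) (- -((l : ℤ) + 1)) θ
        rw [show -1 + - -((l : ℤ) + 1) = l by ring] at this
        rw [this]
        ring
      rw [e, ← mul_assoc]
      exact h2
    have h2 := hasSum_sum (s := Finset.univ) fun a _ => h1 a
    simp_rw [← Finset.mul_sum] at h2
    exact h2.tendsto_sum_nat
  have hslim : Tendsto (fun k => s (k + 1)) atTop (𝓝 (∑ c, ‖((F θ)ᴴ *ᵥ q) c‖ ^ 2)) := by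
    have h1 : Tendsto s atTop (𝓝 (∑ c, ‖expi (-1) θ * ((F θ)ᴴ *ᵥ q) c‖ ^ 2)) :=
      tendsto_finsetSum _ fun c _ => ((hVlim c).norm).pow 2
    simp only [norm_mul, norm_expi, one_mul] at h1
    exact (tendsto_add_atTop_iff_nat 1).2 h1
  refine le_of_tendsto_of_frequently hslim.cesaro ?_
  refine (h.and_eventually (eventually_gt_atTop 0)).mono ?_
  rintro N ⟨hN, hpos⟩
  have hNpos : (0 : ℝ) < N := by exact_mod_cast hpos
  set z : Fin N × Fin m → ℂ := fun p => expi (p.1 : ℕ) θ * q p.2 with hz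
  -- The hypothesis concerns real vectors; since `A` is real, the estimates for real and imaginary
  -- parts add up to the complex one.
  have hre := hN fun p => (z p).re
  have him := hN fun p => (z p).im
  have hw : ∀ (j : Fin N) (c : Fin r), ∑ k : Fin N, (if j ≤ k then
      ∑ a, (T (k - j) a c : ℂ) * z (k, a) else 0) = expi (j : ℕ) θ * V (N - j) c := by
    intro j c
    rw [hV]
    simp only
    rw [← sum_fin_ite_le_sub j (fun l => expi l θ * ∑ a, (T l a c : ℂ) * q a), Finset.mul_sum]
    refine Finset.sum_congr rfl fun k _ => ?_
    split_ifs with hjk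
    · rw [← mul_assoc, ← expi_add, Finset.mul_sum]
      refine Finset.sum_congr rfl fun a _ => ?_
      rw [hz]
      simp only
      have : ((j : ℕ) : ℤ) + (((k : ℕ) - (j : ℕ) : ℕ) : ℤ) = ((k : ℕ) : ℤ) := by
        have : (j : ℕ) ≤ k := hjk
        omega
      rw [this]
      ring
    · simp
  have e1 : ∀ (j : Fin N) (c : Fin r), ((toepl T N)ᵀ *ᵥ fun p => (z p).re) (j, c) =
      (expi (j : ℕ) θ * V (N - j) c).re := fun j c => by
    rw [toepl_transpose_mulVec, ← hw, Complex.re_sum]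
    refine Finset.sum_congr rfl fun k _ => ?_
    split_ifs
    · simp [Matrix.mulVec, dotProduct]
    · simp
  have e2 : ∀ (j : Fin N) (c : Fin r), ((toepl T N)ᵀ *ᵥ fun p => (z p).im) (j, c) =
      (expi (j : ℕ) θ * V (N - j) c).im := fun j c => by
    rw [toepl_transpose_mulVec, ← hw, Complex.im_sum]
    refine Finset.sum_congr rfl fun k _ => ?_
    split_ifs
    · simp [Matrix.mulVec, dotProduct]
    · simp
  have n1 : ∀ w : ℂ, w.re * w.re + w.im * w.im = ‖w‖ ^ 2 := fun w => by
    rw [← Complex.normSq_eq_norm_sq, Complex.normSq_apply]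
  have lhs : ∑ k ∈ Finset.range N, s (k + 1) ≤ γ * (N * ∑ a, ‖q a‖ ^ 2) := by
    have hadd := add_le_add hre him
    rw [← mul_add] at hadd
    have r1 : ((fun p => (z p).re) ⬝ᵥ fun p => (z p).re) + ((fun p => (z p).im) ⬝ᵥ fun p => (z p).im)
        = N * ∑ a, ‖q a‖ ^ 2 := by
      rw [dotProduct, dotProduct, ← Finset.sum_add_distrib]
      simp_rw [n1, Fintype.sum_prod_type, hz, norm_mul, norm_expi, one_mul]
      simp
    have r2 : ((toepl T N)ᵀ *ᵥ fun p => (z p).re) ⬝ᵥ ((toepl T N)ᵀ *ᵥ fun p => (z p).re) +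
        ((toepl T N)ᵀ *ᵥ fun p => (z p).im) ⬝ᵥ ((toepl T N)ᵀ *ᵥ fun p => (z p).im) =
        ∑ k ∈ Finset.range N, s (k + 1) := by
      rw [← sum_fin_sub N s, dotProduct, dotProduct, ← Finset.sum_add_distrib,
        Fintype.sum_prod_type]
      simp_rw [e1, e2, n1, norm_mul, norm_expi, one_mul]
      rfl
    rw [r1, r2] at hadd
    exact hadd
  rw [inv_mul_le_iff₀ hNpos]
  linarith

end Symbol

/-! ### The transfer matrix on the unit circle -/

section Transfer

open scoped Matrix.Norms.L2Operator

variable {n r m : ℕ}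

/-- Gelfand's formula: for `c` strictly between the spectral radius and 1, eventually `‖Aᵏ‖ ≤ cᵏ`.
-/
theorem summable_norm_pow_of_spectralRadius_lt_one {A : Matrix (Fin n) (Fin n) ℂ}
    (h : spectralRadius ℂ A < 1) : Summable fun k : ℕ => ‖A ^ k‖ := by
  obtain ⟨c, hc1, hc2⟩ := ENNReal.lt_iff_exists_nnreal_btwn.1 h
  have hc : (c : ℝ) < 1 := by exact_mod_cast hc2
  have hlim := spectrum.pow_nnnorm_pow_one_div_tendsto_nhds_spectralRadius A
  refine Summable.of_norm_bounded_eventually_nat (summable_geometric_of_lt_one c.2 hc) ?_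
  filter_upwards [hlim.eventually_lt_const hc1, eventually_gt_atTop 0] with k hk hk0
  have hk0' : (0 : ℝ) < k := by exact_mod_cast hk0
  have h2 := ENNReal.rpow_le_rpow hk.le hk0'.le
  rw [← ENNReal.rpow_mul, one_div, inv_mul_cancel₀ hk0'.ne', ENNReal.rpow_one,
    ENNReal.rpow_natCast] at h2
  rw [norm_norm]
  exact_mod_cast h2

/-- The series converges absolutely, and its sum `R` satisfies `z R = 1 + A R`: the series for `z R`
and `A R` differ only in the zeroth term. -/
theorem hasSum_resolvent {A : Matrix (Fin n) (Fin n) ℂ} (h : spectralRadius ℂ A < 1) (θ : ℝ) :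
    HasSum (fun k : ℕ => expi (-(k + 1)) θ • A ^ k)
      (Complex.exp (θ * Complex.I) • (1 : Matrix (Fin n) (Fin n) ℂ) - A)⁻¹ := by
  have hs : Summable fun k : ℕ => expi (-(k + 1)) θ • A ^ k := by
    refine Summable.of_norm_bounded (summable_norm_pow_of_spectralRadius_lt_one h) fun k => ?_
    rw [norm_smul, norm_expi, one_mul]
  obtain ⟨R, hR⟩ := hs
  have hz : Complex.exp (θ * Complex.I) = expi 1 θ := by simp [expi]
  have h1 : HasSum (fun k : ℕ => expi (-k) θ • A ^ k)
      (expi 1 θ • (1 : Matrix (Fin n) (Fin n) ℂ) * R) := by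
    have e : (fun k : ℕ => expi (-k) θ • A ^ k) = fun k : ℕ =>
        (expi 1 θ • (1 : Matrix (Fin n) (Fin n) ℂ)) * (expi (-(k + 1)) θ • A ^ k) := by
      ext1 k
      rw [smul_mul_assoc, one_mul, smul_smul, ← expi_add]
      congr 2
      ring
    rw [e]
    exact hR.mul_left (expi 1 θ • (1 : Matrix (Fin n) (Fin n) ℂ))
  have h2 : HasSum (fun k : ℕ => expi (-((k + 1 : ℕ) : ℤ)) θ • A ^ (k + 1)) (A * R) := by
    have e : (fun k : ℕ => expi (-((k + 1 : ℕ) : ℤ)) θ • A ^ (k + 1)) = fun k : ℕ =>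
        A * (expi (-(k + 1)) θ • A ^ k) := by
      ext1 k
      rw [mul_smul_comm, pow_succ']
      push_cast
      rfl
    rw [e]
    exact hR.mul_left A
  have h3 := (hasSum_nat_add_iff (f := fun k : ℕ => expi (-(k : ℤ)) θ • A ^ k) 1).1 h2
  have h4 := h1.unique h3
  have hinv : (expi 1 θ • (1 : Matrix (Fin n) (Fin n) ℂ) - A) * R = 1 := by
    rw [sub_mul, h4]
    simp [expi]
  rw [hz, Matrix.inv_eq_right_inv hinv]
  exact hR

/-- The normalised transfer matrix on the unit circle. -/
noncomputable def symbol (G : Matrix (Fin n) (Fin n) ℝ) (K : Fin r ↪ Fin n)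
    (J : Fin m ↪ Fin n) (D : Matrix (Fin r) (Fin r) ℝ) (θ : ℝ) : Matrix (Fin m) (Fin r) ℂ :=
  transfer ℂ G K J (Complex.exp (θ * Complex.I)) * (psdSqrt D).map (algebraMap ℝ ℂ)

theorem selection_map {q : ℕ} (s : Fin q ↪ Fin n) :
    (selection ℝ s).map (algebraMap ℝ ℂ) = selection ℂ s := by
  ext i a
  simp only [selection, Matrix.map_apply, Matrix.of_apply]
  split_ifs <;> simp

theorem nimpulse_map (G : Matrix (Fin n) (Fin n) ℝ) (K : Fin r ↪ Fin n)
    (J : Fin m ↪ Fin n) (D : Matrix (Fin r) (Fin r) ℝ) (k : ℕ) :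
    (nimpulse G K J D k).map (algebraMap ℝ ℂ) =
      (selection ℂ J)ᵀ * (G.map (algebraMap ℝ ℂ)) ^ k * selection ℂ K *
        (psdSqrt D).map (algebraMap ℝ ℂ) := by
  rw [nimpulse, impulse, Matrix.map_mul, Matrix.map_mul, Matrix.map_mul, Matrix.map_pow,
    Matrix.transpose_map, selection_map, selection_map]

theorem summable_norm_nimpulse {G : Matrix (Fin n) (Fin n) ℝ} (hG : IsStable G) (K : Fin r ↪ Fin n)
    (J : Fin m ↪ Fin n) (D : Matrix (Fin r) (Fin r) ℝ) :
    Summable fun k => ‖(nimpulse G K J D k).map (algebraMap ℝ ℂ)‖ := by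
  have h := summable_norm_pow_of_spectralRadius_lt_one hG
  refine Summable.of_nonneg_of_le (fun k => norm_nonneg _) (fun k => ?_)
    (((h.mul_left ‖(selection ℂ J)ᵀ‖).mul_right ‖selection ℂ K‖).mul_right
      ‖(psdSqrt D).map (algebraMap ℝ ℂ)‖)
  rw [nimpulse_map]
  refine (Matrix.l2_opNorm_mul _ _).trans ?_
  gcongr
  refine (Matrix.l2_opNorm_mul _ _).trans ?_
  gcongr
  exact Matrix.l2_opNorm_mul _ _

theorem summable_abs_nimpulse {G : Matrix (Fin n) (Fin n) ℝ} (hG : IsStable G) (K : Fin r ↪ Fin n)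
    (J : Fin m ↪ Fin n) (D : Matrix (Fin r) (Fin r) ℝ) (a : Fin m) (c : Fin r) :
    Summable fun k => |nimpulse G K J D k a c| := by
  refine Summable.of_nonneg_of_le (fun k => abs_nonneg _) (fun k => ?_)
    (summable_norm_nimpulse hG K J D)
  refine le_trans (le_of_eq ?_) (norm_entry_le _ a c)
  simp

theorem hasSum_symbol_matrix {G : Matrix (Fin n) (Fin n) ℝ} (hG : IsStable G) (K : Fin r ↪ Fin n)
    (J : Fin m ↪ Fin n) (D : Matrix (Fin r) (Fin r) ℝ) (θ : ℝ) :
    HasSum (fun k : ℕ => expi (-(k + 1)) θ • (nimpulse G K J D k).map (algebraMap ℝ ℂ))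
      (symbol G K J D θ) := by
  have h := hasSum_resolvent hG θ
  have h2 := h.map (⟨⟨fun X : Matrix (Fin n) (Fin n) ℂ => (selection ℂ J)ᵀ * X * selection ℂ K *
    (psdSqrt D).map (algebraMap ℝ ℂ), by simp⟩, fun X Y => by
      simp [Matrix.mul_add, Matrix.add_mul]⟩ : _ →+ Matrix (Fin m) (Fin r) ℂ)
    (by
      change Continuous fun X : Matrix (Fin n) (Fin n) ℂ => (selection ℂ J)ᵀ * X * selection ℂ K *
        (psdSqrt D).map (algebraMap ℝ ℂ)
      fun_prop)
  have e : (fun k : ℕ => expi (-(k + 1)) θ • (nimpulse G K J D k).map (algebraMap ℝ ℂ)) =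
      fun k : ℕ => (selection ℂ J)ᵀ * (expi (-(k + 1)) θ • (G.map (algebraMap ℝ ℂ)) ^ k) *
        selection ℂ K * (psdSqrt D).map (algebraMap ℝ ℂ) := by
    ext1 k
    rw [nimpulse_map, Matrix.mul_smul, Matrix.smul_mul, Matrix.smul_mul]
  rw [e]
  exact h2

theorem hasSum_symbol {G : Matrix (Fin n) (Fin n) ℝ} (hG : IsStable G) (K : Fin r ↪ Fin n)
    (J : Fin m ↪ Fin n) (D : Matrix (Fin r) (Fin r) ℝ) (θ : ℝ) (a : Fin m) (c : Fin r) :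
    HasSum (fun k : ℕ => expi (-(k + 1)) θ * (nimpulse G K J D k a c : ℂ))
      (symbol G K J D θ a c) := by
  have h := (hasSum_symbol_matrix hG K J D θ).map
    (⟨⟨fun X : Matrix (Fin m) (Fin r) ℂ => X a c, rfl⟩, fun X Y => rfl⟩ :
      Matrix (Fin m) (Fin r) ℂ →+ ℂ)
    (by
      change Continuous fun X : Matrix (Fin m) (Fin r) ℂ => X a c
      fun_prop)
  exact h

/-- Boundedness makes the real-valued `essSup` in `gain` a genuine almost everywhere bound. -/
theorem exists_norm_symbol_le {G : Matrix (Fin n) (Fin n) ℝ} (hG : IsStable G) (K : Fin r ↪ Fin n)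
    (J : Fin m ↪ Fin n) (D : Matrix (Fin r) (Fin r) ℝ) : ∃ B, ∀ θ, ‖symbol G K J D θ‖ ≤ B := by
  refine ⟨∑' k, ‖(nimpulse G K J D k).map (algebraMap ℝ ℂ)‖, fun θ => ?_⟩
  rw [← (hasSum_symbol_matrix hG K J D θ).tsum_eq]
  refine tsum_of_norm_bounded (summable_norm_nimpulse hG K J D).hasSum fun k => ?_
  rw [norm_smul, norm_expi, one_mul]

theorem ae_norm_symbol_le_gain {G : Matrix (Fin n) (Fin n) ℝ} (hG : IsStable G) (K : Fin r ↪ Fin n)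
    (J : Fin m ↪ Fin n) (D : Matrix (Fin r) (Fin r) ℝ) :
    ∀ᵐ θ ∂(volume.restrict (Set.Icc 0 (2 * Real.pi))), ‖symbol G K J D θ‖ ≤ gain G K J D := by
  obtain ⟨B, hB⟩ := exists_norm_symbol_le hG K J D
  exact ae_le_essSup (f := fun θ => ‖symbol G K J D θ‖) (isBoundedUnder_of ⟨B, hB⟩)

theorem neBot_ae_circle : (ae (volume.restrict (Set.Icc 0 (2 * Real.pi)))).NeBot := by
  rw [ae_neBot, Ne, Measure.restrict_eq_zero, Real.volume_Icc]
  simp [Real.pi_pos]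

theorem gain_nonneg {G : Matrix (Fin n) (Fin n) ℝ} (hG : IsStable G) (K : Fin r ↪ Fin n)
    (J : Fin m ↪ Fin n) (D : Matrix (Fin r) (Fin r) ℝ) : 0 ≤ gain G K J D := by
  have := neBot_ae_circle
  obtain ⟨θ, hθ⟩ := (ae_norm_symbol_le_gain hG K J D).exists
  exact (norm_nonneg _).trans hθ

theorem gain_le_of_forall (G : Matrix (Fin n) (Fin n) ℝ) (K : Fin r ↪ Fin n)
    (J : Fin m ↪ Fin n) (D : Matrix (Fin r) (Fin r) ℝ) {s : ℝ}
    (h : ∀ θ, ‖symbol G K J D θ‖ ≤ s) : gain G K J D ≤ s := by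
  have := neBot_ae_circle
  exact essSup_le_of_ae_le (f := fun θ => ‖symbol G K J D θ‖) s (ae_of_all _ h)
    (isBoundedUnder_of ⟨0, fun θ => norm_nonneg _⟩ : IsBoundedUnder (· ≥ ·) _ _).isCoboundedUnder_le

theorem nimpulse_transpose_sq_le {G : Matrix (Fin n) (Fin n) ℝ} (hG : IsStable G)
    (K : Fin r ↪ Fin n) (J : Fin m ↪ Fin n) (D : Matrix (Fin r) (Fin r) ℝ) (N : ℕ)
    (b : Fin N × Fin m → ℝ) :
    ((toepl (nimpulse G K J D) N)ᵀ *ᵥ b) ⬝ᵥ ((toepl (nimpulse G K J D) N)ᵀ *ᵥ b) ≤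
      gain G K J D ^ 2 * (b ⬝ᵥ b) :=
  toepl_transpose_sq_le (summable_abs_nimpulse hG K J D) (hasSum_symbol hG K J D)
    (gain_nonneg hG K J D) (ae_norm_symbol_le_gain hG K J D) N b

/-- Converse to `nimpulse_transpose_sq_le`: no constant below `gain²` can bound the Rayleigh
quotients for infinitely many `N`. This is the form used when arguing by contradiction. -/
theorem gain_sq_le_of_frequently {G : Matrix (Fin n) (Fin n) ℝ} (hG : IsStable G)
    (K : Fin r ↪ Fin n) (J : Fin m ↪ Fin n) (D : Matrix (Fin r) (Fin r) ℝ) {γ : ℝ} (hγ : 0 ≤ γ)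
    (h : ∃ᶠ N : ℕ in atTop, ∀ b : Fin N × Fin m → ℝ,
      ((toepl (nimpulse G K J D) N)ᵀ *ᵥ b) ⬝ᵥ ((toepl (nimpulse G K J D) N)ᵀ *ᵥ b) ≤
        γ * (b ⬝ᵥ b)) : gain G K J D ^ 2 ≤ γ := by
  have h1 := gain_le_of_forall G K J D
    (symbol_norm_le_of_frequently (hasSum_symbol hG K J D) h)
  have h2 := gain_nonneg hG K J D
  calc gain G K J D ^ 2 ≤ √γ ^ 2 := by gcongr
    _ = γ := Real.sq_sqrt hγ

end Transfer

/-! ### The covariance shift model -/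

section Divergence

/-- The symmetrised divergence of two centred Gaussian laws with variances
`σ₁² α + σᵥ² β` and `σ₂² α + σᵥ² β`. -/
noncomputable def gaussDiv (σ₁ σ₂ σv α β : ℝ) : ℝ :=
  ((σ₁ ^ 2 * α + σv ^ 2 * β) - (σ₂ ^ 2 * α + σv ^ 2 * β)) ^ 2 /
    (4 * ((σ₁ ^ 2 * α + σv ^ 2 * β) * (σ₂ ^ 2 * α + σv ^ 2 * β)))

variable {σ₁ σ₂ σv α β α' β' : ℝ}

theorem gaussDiv_zero (β : ℝ) : gaussDiv σ₁ σ₂ σv 0 β = 0 := by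
  simp [gaussDiv]

theorem var_pos (hσ : 0 < σv ∨ 0 < σ₂) (hα : 0 < α) (hβ : 0 < β) :
    0 < σ₂ ^ 2 * α + σv ^ 2 * β := by
  rcases hσ with h | h <;> positivity

theorem var_lt_var (h : σ₂ ^ 2 < σ₁ ^ 2) (hα : 0 < α) :
    σ₂ ^ 2 * α + σv ^ 2 * β < σ₁ ^ 2 * α + σv ^ 2 * β := by
  have := mul_lt_mul_of_pos_right h hα
  linarith

theorem gaussDiv_pos (h : σ₂ ^ 2 < σ₁ ^ 2) (hσ : 0 < σv ∨ 0 < σ₂) (hα : 0 < α) (hβ : 0 < β) :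
    0 < gaussDiv σ₁ σ₂ σv α β := by
  have h2 := var_pos hσ hα hβ
  have h1 := var_lt_var (σv := σv) (β := β) h hα
  have h3 := h2.trans h1
  have h4 := sub_pos.2 h1
  unfold gaussDiv
  positivity

/-- Numerator and denominator are homogeneous of degree 2 in `(α, β)`, so only `β / α` matters, and
it appears only in the denominator. -/
theorem gaussDiv_eq (hα : 0 < α) :
    gaussDiv σ₁ σ₂ σv α β = (σ₁ ^ 2 - σ₂ ^ 2) ^ 2 /
      (4 * ((σ₁ ^ 2 + σv ^ 2 * (β / α)) * (σ₂ ^ 2 + σv ^ 2 * (β / α)))) := by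
  have e : ∀ s : ℝ, s ^ 2 * α + σv ^ 2 * β = α * (s ^ 2 + σv ^ 2 * (β / α)) := fun s => by
    field_simp
  rw [gaussDiv, e, e, ← mul_sub, add_sub_add_right_eq_sub]
  rw [show 4 * (α * (σ₁ ^ 2 + σv ^ 2 * (β / α)) * (α * (σ₂ ^ 2 + σv ^ 2 * (β / α)))) =
    α ^ 2 * (4 * ((σ₁ ^ 2 + σv ^ 2 * (β / α)) * (σ₂ ^ 2 + σv ^ 2 * (β / α)))) by ring, mul_pow,
    mul_div_mul_left _ _ (by positivity)]

theorem gaussDiv_mono (h : σ₂ ^ 2 < σ₁ ^ 2) (hσ : 0 < σv ∨ 0 < σ₂) (hα : 0 < α) (hβ : 0 < β)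
    (hα' : 0 < α') (hβ' : 0 < β') (hle : α' * β ≤ α * β') :
    gaussDiv σ₁ σ₂ σv α' β' ≤ gaussDiv σ₁ σ₂ σv α β := by
  rw [gaussDiv_eq hα, gaussDiv_eq hα']
  have ht : β / α ≤ β' / α' := by rw [div_le_div_iff₀ hα hα']; linarith
  have hσ₁ : 0 < σ₁ ^ 2 := (sq_nonneg σ₂).trans_lt h
  have hβα : 0 < β / α := div_pos hβ hα
  have hden : 0 < σ₂ ^ 2 + σv ^ 2 * (β / α) := by rcases hσ with h | h <;> positivity
  gcongr

/-- Strict monotonicity in `β / α`. It fails for `σv = 0`, when the divergence no longer depends on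
this quotient. -/
theorem mul_le_mul_of_gaussDiv_le (h : σ₂ ^ 2 < σ₁ ^ 2) (hσv : 0 < σv) (hα : 0 < α) (_hβ : 0 < β)
    (hα' : 0 < α') (hβ' : 0 < β')
    (hle : gaussDiv σ₁ σ₂ σv α' β' ≤ gaussDiv σ₁ σ₂ σv α β) : α' * β ≤ α * β' := by
  by_contra hcon
  rw [not_le] at hcon
  refine absurd hle (not_le.2 ?_)
  rw [gaussDiv_eq hα, gaussDiv_eq hα']
  have ht : β' / α' < β / α := by rw [div_lt_div_iff₀ hα' hα]; linarith
  have hσ₁ : 0 < σ₁ ^ 2 := (sq_nonneg σ₂).trans_lt h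
  have hΔ : 0 < σ₁ ^ 2 - σ₂ ^ 2 := sub_pos.2 h
  have hden : 0 < σ₂ ^ 2 + σv ^ 2 * (β' / α') := by positivity
  apply div_lt_div_of_pos_left (by positivity) (by positivity)
  gcongr

end Divergence

/-! ### LD-MAP vectors as maximisers of the Toeplitz Rayleigh quotient, and their limit -/

section CovShift

variable {n r m : ℕ}

/-- The squared norm of `Aᵀ b`, with `A` the block Toeplitz matrix of `T`. -/
def responseSq (T : ℕ → Matrix (Fin m) (Fin r) ℝ) (N : ℕ) (b : Fin N × Fin m → ℝ) : ℝ :=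
  ((toepl T N)ᵀ *ᵥ b) ⬝ᵥ ((toepl T N)ᵀ *ᵥ b)

theorem responseSq_nonneg (T : ℕ → Matrix (Fin m) (Fin r) ℝ) (N : ℕ) (b : Fin N × Fin m → ℝ) :
    0 ≤ responseSq T N b := dotProduct_self_nonneg' _

theorem responseSq_smul (T : ℕ → Matrix (Fin m) (Fin r) ℝ) (N : ℕ) (b : Fin N × Fin m → ℝ)
    (s : ℝ) : responseSq T N (s • b) = s ^ 2 * responseSq T N b := by
  simp only [responseSq, Matrix.mulVec_smul, smul_dotProduct, dotProduct_smul, smul_eq_mul]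
  ring

theorem dotProduct_self_pos_of_responseSq_pos {T : ℕ → Matrix (Fin m) (Fin r) ℝ} {N : ℕ}
    {b : Fin N × Fin m → ℝ} (h : 0 < responseSq T N b) : 0 < b ⬝ᵥ b := by
  refine lt_of_le_of_ne (dotProduct_self_nonneg' b) fun h0 => ?_
  rw [dotProduct_self_eq_zero.1 h0.symm] at h
  simp [responseSq] at h

/-- The mean `c` is chosen before `σ`: both hypotheses share it, as the scalar formulas require. -/
theorem exists_discriminantLaw_hypLaw (G : Matrix (Fin n) (Fin n) ℝ) (K : Fin r ↪ Fin n)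
    (J : Fin m ↪ Fin n) {D : Matrix (Fin r) (Fin r) ℝ} (hD : D.PosDef) (σv : ℝ) (N : ℕ) (μ : ℝ)
    (b : EuclideanSpace ℝ (Fin N × Fin m)) :
    ∃ c : ℝ, ∀ σ, discriminantLaw (hypLaw G K J D σv N μ σ) b =
      gaussianReal c (σ ^ 2 * responseSq (nimpulse G K J D) N b.ofLp +
        σv ^ 2 * (b.ofLp ⬝ᵥ b.ofLp)).toNNReal := by
  refine ⟨inner ℝ (WithLp.toLp 2 (toepl (impulse G K J) N *ᵥ fun _ => μ)) b, fun σ => ?_⟩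
  rw [hypLaw_eq G K J hD, discriminantLaw_multivariateGaussian _ _ (posSemidef_obsCov _ _ _ _),
    dotProduct_obsCov]
  rfl

theorem iDivergence_hypLaw (G : Matrix (Fin n) (Fin n) ℝ) (K : Fin r ↪ Fin n)
    (J : Fin m ↪ Fin n) {D : Matrix (Fin r) (Fin r) ℝ} (hD : D.PosDef) {σ₁ σ₂ σv : ℝ}
    (h : σ₂ ^ 2 < σ₁ ^ 2) (hσ : 0 < σv ∨ 0 < σ₂) (N : ℕ) (μ : ℝ)
    (b : EuclideanSpace ℝ (Fin N × Fin m)) :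
    iDivergence (hypLaw G K J D σv N μ σ₁) (hypLaw G K J D σv N μ σ₂) b =
      ENNReal.ofReal (gaussDiv σ₁ σ₂ σv (responseSq (nimpulse G K J D) N b.ofLp)
        (b.ofLp ⬝ᵥ b.ofLp)) := by
  obtain ⟨c, hc⟩ := exists_discriminantLaw_hypLaw G K J hD σv N μ b
  rw [iDivergence, hc, hc]
  set α := responseSq (nimpulse G K J D) N b.ofLp with hα
  set β := b.ofLp ⬝ᵥ b.ofLp with hβ
  have hα0 : 0 ≤ α := responseSq_nonneg _ _ _
  have hβ0 : 0 ≤ β := dotProduct_self_nonneg' _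
  have hv1 : 0 ≤ σ₁ ^ 2 * α + σv ^ 2 * β := by positivity
  have hv2 : 0 ≤ σ₂ ^ 2 * α + σv ^ 2 * β := by positivity
  rw [symm_klDiv_gaussianReal, Real.coe_toNNReal _ hv1, Real.coe_toNNReal _ hv2]
  · rfl
  -- The variances vanish together: for `α = 0` they are equal, and for `α > 0` both are positive.
  · rcases hα0.eq_or_lt with h0 | hpos
    · rw [← h0]; simp
    · have hβpos : 0 < β := dotProduct_self_pos_of_responseSq_pos hpos
      have p2 := var_pos hσ hpos hβpos
      have p1 := p2.trans (var_lt_var (σv := σv) (β := β) h hpos)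
      simp only [Real.toNNReal_eq_zero]
      constructor <;> intro hle <;> linarith

theorem ldRatio_hypLaw (G : Matrix (Fin n) (Fin n) ℝ) (K : Fin r ↪ Fin n)
    (J : Fin m ↪ Fin n) {D : Matrix (Fin r) (Fin r) ℝ} (hD : D.PosDef) (σ₁ σ₂ σv : ℝ)
    (N : ℕ) (μ : ℝ) (b : EuclideanSpace ℝ (Fin N × Fin m)) :
    ldRatio (hypLaw G K J D σv N μ σ₁) (hypLaw G K J D σv N μ σ₂) b =
      (σ₁ ^ 2 * responseSq (nimpulse G K J D) N b.ofLp + σv ^ 2 * (b.ofLp ⬝ᵥ b.ofLp)) /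
        (σ₂ ^ 2 * responseSq (nimpulse G K J D) N b.ofLp + σv ^ 2 * (b.ofLp ⬝ᵥ b.ofLp)) := by
  rw [ldRatio, hypLaw_eq G K J hD, hypLaw_eq G K J hD,
    covMat_multivariateGaussian _ (posSemidef_obsCov _ _ _ _),
    covMat_multivariateGaussian _ (posSemidef_obsCov _ _ _ _), dotProduct_obsCov,
    dotProduct_obsCov]
  rfl

/-- The error probability of the MAP detector for two centred Gaussian laws with ratio of
variances `R`. -/
noncomputable def ratioError (R : ℝ) : ℝ :=
  (1 / 2) * (1 - QChiSq (Real.log R / (R - 1))) + (1 / 2) * QChiSq (Real.log R / (R - 1) * R)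

theorem continuousAt_ratioError {R : ℝ} (hR : 1 < R) : ContinuousAt ratioError R := by
  have hR0 : R ≠ 0 := by linarith
  have h1 : R - 1 ≠ 0 := by linarith
  have hτ : 0 < Real.log R / (R - 1) := div_pos (Real.log_pos hR) (by linarith)
  have cτ : ContinuousAt (fun R => Real.log R / (R - 1)) R :=
    (Real.continuousAt_log hR0).div (by fun_prop) h1
  have cτ' : ContinuousAt (fun R => Real.log R / (R - 1) * R) R := cτ.mul continuousAt_id
  have c1 : ContinuousAt (fun R => QChiSq (Real.log R / (R - 1))) R :=
    ContinuousAt.comp (g := QChiSq) (continuousAt_QChiSq hτ) cτ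
  have c2 : ContinuousAt (fun R => QChiSq (Real.log R / (R - 1) * R)) R :=
    ContinuousAt.comp (g := QChiSq)
      (continuousAt_QChiSq (mul_pos hτ (by linarith))) cτ'
  exact (continuousAt_const.mul (continuousAt_const.sub c1)).add (continuousAt_const.mul c2)

theorem ldMapError_hypLaw (G : Matrix (Fin n) (Fin n) ℝ) (K : Fin r ↪ Fin n)
    (J : Fin m ↪ Fin n) {D : Matrix (Fin r) (Fin r) ℝ} (hD : D.PosDef) {σ₁ σ₂ σv : ℝ}
    (h : σ₂ ^ 2 < σ₁ ^ 2) (hσ : 0 < σv ∨ 0 < σ₂) (N : ℕ) (μ : ℝ)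
    (b : EuclideanSpace ℝ (Fin N × Fin m))
    (hb : 0 < responseSq (nimpulse G K J D) N b.ofLp) :
    ldMapError (hypLaw G K J D σv N μ σ₁) (hypLaw G K J D σv N μ σ₂) b =
      ratioError (ldRatio (hypLaw G K J D σv N μ σ₁) (hypLaw G K J D σv N μ σ₂) b) := by
  obtain ⟨c, hc⟩ := exists_discriminantLaw_hypLaw G K J hD σv N μ b
  have p2 := var_pos hσ hb (dotProduct_self_pos_of_responseSq_pos hb)
  have p12 := var_lt_var (σv := σv) (β := b.ofLp ⬝ᵥ b.ofLp) h hb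
  rw [ldMapError, hc, hc, mapError_gaussianReal, ldRatio_hypLaw G K J hD,
    Real.coe_toNNReal _ (p2.trans p12).le, Real.coe_toNNReal _ p2.le]
  · rfl
  · simpa using p2
  · exact (Real.toNNReal_lt_toNNReal_iff (p2.trans p12)).2 p12

theorem responseSq_pos_of_isLDMAP {G : Matrix (Fin n) (Fin n) ℝ} {K : Fin r ↪ Fin n}
    {J : Fin m ↪ Fin n} {D : Matrix (Fin r) (Fin r) ℝ} (hD : D.PosDef) {σ₁ σ₂ σv : ℝ}
    (h : σ₂ ^ 2 < σ₁ ^ 2) (hσ : 0 < σv ∨ 0 < σ₂) {N : ℕ} {μ : ℝ}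
    {b : EuclideanSpace ℝ (Fin N × Fin m)}
    (hb : IsLDMAP (hypLaw G K J D σv N μ σ₁) (hypLaw G K J D σv N μ σ₂) b) :
    0 < responseSq (nimpulse G K J D) N b.ofLp := by
  refine lt_of_le_of_ne (responseSq_nonneg _ _ _) fun h0 => ?_
  have := hb.1
  rw [iDivergence_hypLaw G K J hD h hσ, ← h0, gaussDiv_zero] at this
  simp at this

theorem responseSq_le_of_isLDMAP {G : Matrix (Fin n) (Fin n) ℝ} {K : Fin r ↪ Fin n}
    {J : Fin m ↪ Fin n} {D : Matrix (Fin r) (Fin r) ℝ} (hD : D.PosDef) {σ₁ σ₂ σv : ℝ}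
    (h : σ₂ ^ 2 < σ₁ ^ 2) (hσv : 0 < σv) {N : ℕ} {μ : ℝ}
    {b : EuclideanSpace ℝ (Fin N × Fin m)}
    (hb : IsLDMAP (hypLaw G K J D σv N μ σ₁) (hypLaw G K J D σv N μ σ₂) b)
    (b' : Fin N × Fin m → ℝ) :
    responseSq (nimpulse G K J D) N b' ≤
      responseSq (nimpulse G K J D) N b.ofLp / (b.ofLp ⬝ᵥ b.ofLp) * (b' ⬝ᵥ b') := by
  have hα := responseSq_pos_of_isLDMAP hD h (Or.inl hσv) hb
  have hβ := dotProduct_self_pos_of_responseSq_pos hα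
  rcases (responseSq_nonneg (nimpulse G K J D) N b').eq_or_lt with h0 | hα'
  · rw [← h0]
    exact mul_nonneg (div_nonneg hα.le hβ.le) (dotProduct_self_nonneg' b')
  · have hβ' := dotProduct_self_pos_of_responseSq_pos hα'
    have hle := hb.2 (WithLp.toLp 2 b')
    rw [iDivergence_hypLaw G K J hD h (Or.inl hσv), iDivergence_hypLaw G K J hD h (Or.inl hσv),
      ENNReal.ofReal_le_ofReal_iff (gaussDiv_pos h (Or.inl hσv) hα hβ).le] at hle
    have := mul_le_mul_of_gaussDiv_le h hσv hα hβ hα' hβ' hle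
    rw [div_mul_eq_mul_div, le_div_iff₀ hβ]
    exact this

/-- By compactness `|Aᵀ b|²` attains its maximum on the unit sphere, and by homogeneity the
maximiser has the largest Rayleigh quotient among all vectors. Monotonicity of `gaussDiv` transfers
this to the divergence; vectors with zero response have divergence 0. -/
theorem exists_isLDMAP {G : Matrix (Fin n) (Fin n) ℝ} {K : Fin r ↪ Fin n}
    {J : Fin m ↪ Fin n} {D : Matrix (Fin r) (Fin r) ℝ} (hD : D.PosDef) {σ₁ σ₂ σv : ℝ}
    (h : σ₂ ^ 2 < σ₁ ^ 2) (hσ : 0 < σv ∨ 0 < σ₂) {N : ℕ} (μ : ℝ)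
    {b₀ : Fin N × Fin m → ℝ} (hb₀ : 0 < responseSq (nimpulse G K J D) N b₀) :
    ∃ b, IsLDMAP (hypLaw G K J D σv N μ σ₁) (hypLaw G K J D σv N μ σ₂) b := by
  set T := nimpulse G K J D with hT
  have hsq : ∀ b : EuclideanSpace ℝ (Fin N × Fin m), b.ofLp ⬝ᵥ b.ofLp = ‖b‖ ^ 2 := fun b => by
    rw [← inner_toLp_eq, real_inner_self_eq_norm_sq]
  have hcont : Continuous fun b : EuclideanSpace ℝ (Fin N × Fin m) => responseSq T N b.ofLp := by
    simp only [responseSq, Matrix.mulVec, dotProduct]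
    fun_prop
  set e₀ : EuclideanSpace ℝ (Fin N × Fin m) := WithLp.toLp 2 b₀ with he₀
  have hn₀ : 0 < ‖e₀‖ := by
    have := dotProduct_self_pos_of_responseSq_pos hb₀
    rw [show b₀ = e₀.ofLp from rfl, hsq] at this
    exact lt_of_le_of_ne (norm_nonneg _) fun h0 => by simp [← h0] at this
  have hne : (Metric.sphere (0 : EuclideanSpace ℝ (Fin N × Fin m)) 1).Nonempty :=
    ⟨‖e₀‖⁻¹ • e₀, by rw [mem_sphere_zero_iff_norm, norm_smul, norm_inv, norm_norm,
      inv_mul_cancel₀ hn₀.ne']⟩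
  obtain ⟨b, hbs, hmax⟩ := (isCompact_sphere _ _).exists_isMaxOn hne hcont.continuousOn
  rw [mem_sphere_zero_iff_norm] at hbs
  have hβ1 : b.ofLp ⬝ᵥ b.ofLp = 1 := by rw [hsq, hbs, one_pow]
  have hall : ∀ b' : EuclideanSpace ℝ (Fin N × Fin m),
      responseSq T N b'.ofLp ≤ responseSq T N b.ofLp * (b'.ofLp ⬝ᵥ b'.ofLp) := by
    intro b'
    rcases (norm_nonneg b').eq_or_lt with h0 | hpos
    · have : b' = 0 := norm_eq_zero.1 h0.symm
      simp [this, responseSq]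
    · have hmem : ‖b'‖⁻¹ • b' ∈ Metric.sphere (0 : EuclideanSpace ℝ (Fin N × Fin m)) 1 := by
        rw [mem_sphere_zero_iff_norm, norm_smul, norm_inv, norm_norm, inv_mul_cancel₀ hpos.ne']
      have := hmax hmem
      simp only [Set.mem_ofPred_eq, WithLp.ofLp_smul, responseSq_smul] at this
      rw [hsq]
      rw [inv_pow, inv_mul_le_iff₀ (by positivity)] at this
      linarith
  have hα : 0 < responseSq T N b.ofLp := by
    have h1 := hb₀.trans_le (hall e₀)
    exact pos_of_mul_pos_left h1 (dotProduct_self_nonneg' _)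
  refine ⟨b, ?_, fun b' => ?_⟩
  · rw [iDivergence_hypLaw G K J hD h hσ, ENNReal.ofReal_pos]
    exact gaussDiv_pos h hσ hα (by rw [hβ1]; exact one_pos)
  · rw [iDivergence_hypLaw G K J hD h hσ, iDivergence_hypLaw G K J hD h hσ]
    apply ENNReal.ofReal_le_ofReal
    rcases (responseSq_nonneg T N b'.ofLp).eq_or_lt with h0 | hα'
    · rw [← hT, ← h0, gaussDiv_zero]
      exact (gaussDiv_pos h hσ hα (by rw [hβ1]; exact one_pos)).le
    · refine gaussDiv_mono h hσ hα (by rw [hβ1]; exact one_pos) hα'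
        (dotProduct_self_pos_of_responseSq_pos hα') ?_
      rw [hβ1, mul_one]
      exact hall b'

theorem eventually_exists_responseSq_pos {G : Matrix (Fin n) (Fin n) ℝ} (hG : IsStable G)
    (K : Fin r ↪ Fin n) (J : Fin m ↪ Fin n) (D : Matrix (Fin r) (Fin r) ℝ)
    (hg : 0 < gain G K J D) :
    ∀ᶠ N : ℕ in atTop, ∃ b : Fin N × Fin m → ℝ, 0 < responseSq (nimpulse G K J D) N b := by
  by_contra hcon
  rw [not_eventually] at hcon
  -- If no vector had a positive response for infinitely many `N`, the bound would hold with `γ =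
  -- 0`.
  have h := gain_sq_le_of_frequently hG K J D le_rfl (hcon.mono fun N hN b => by
    rw [not_exists] at hN
    rw [zero_mul]
    exact not_lt.1 (hN b))
  have : 0 < gain G K J D ^ 2 := by positivity
  linarith

/-- The optimal Rayleigh quotients never exceed `gain²`. If they were at most `c < gain²` infinitely
often, optimality would extend the bound `c` to all vectors, contradicting
`gain_sq_le_of_frequently`. The inequality `1 < R_s` is what makes `ratioError` continuous at the
limit. -/
theorem tendsto_ldRatio {G : Matrix (Fin n) (Fin n) ℝ} (hG : IsStable G) (K : Fin r ↪ Fin n)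
    (J : Fin m ↪ Fin n) {D : Matrix (Fin r) (Fin r) ℝ} (hD : D.PosDef) {σ₁ σ₂ σv : ℝ}
    (h : σ₂ ^ 2 < σ₁ ^ 2) (hσv : 0 ≤ σv) (hσ : 0 < σv ∨ 0 < σ₂) (μ : ℝ)
    {b : (N : ℕ) → EuclideanSpace ℝ (Fin N × Fin m)}
    (hb : ∀ᶠ N : ℕ in atTop,
      IsLDMAP (hypLaw G K J D σv N μ σ₁) (hypLaw G K J D σv N μ σ₂) (b N)) :
    1 < ratioLim G K J D σ₁ σ₂ σv ∧
    Tendsto (fun N => ldRatio (hypLaw G K J D σv N μ σ₁) (hypLaw G K J D σv N μ σ₂) (b N)) atTop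
      (𝓝 (ratioLim G K J D σ₁ σ₂ σv)) := by
  set T := nimpulse G K J D with hT
  set g := gain G K J D with hgdef
  have hα : ∀ᶠ N : ℕ in atTop, 0 < responseSq T N (b N).ofLp :=
    hb.mono fun N hN => responseSq_pos_of_isLDMAP hD h hσ hN
  have hle : ∀ N, responseSq T N (b N).ofLp ≤ g ^ 2 * ((b N).ofLp ⬝ᵥ (b N).ofLp) := fun N =>
    nimpulse_transpose_sq_le hG K J D N _
  -- Existence of an LD-MAP vector already forces the gain to be nonzero.
  have hg2 : 0 < g ^ 2 := by
    obtain ⟨N, hN⟩ := hα.exists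
    exact pos_of_mul_pos_left (hN.trans_le (hle N)) (dotProduct_self_nonneg' _)
  have hden : 0 < σ₂ ^ 2 * g ^ 2 + σv ^ 2 := by
    have := var_pos hσ hg2 one_pos
    rwa [mul_one] at this
  refine ⟨?_, ?_⟩
  · rw [ratioLim, ← hgdef, one_lt_div hden]
    have := mul_lt_mul_of_pos_right h hg2
    linarith
  -- Without sensor noise optimality says nothing about `ρ`, but the variance ratio is `σ₁² / σ₂²`
  -- for every `b` with nonzero response.
  rcases hσv.eq_or_lt with h0 | hpos
  · have hσ₂ : 0 < σ₂ := hσ.resolve_left (by rw [← h0]; exact lt_irrefl _)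
    have e : ∀ x : ℝ, 0 < x → (σ₁ ^ 2 * x) / (σ₂ ^ 2 * x) = σ₁ ^ 2 / σ₂ ^ 2 := fun x hx =>
      mul_div_mul_right _ _ hx.ne'
    have e2 : ratioLim G K J D σ₁ σ₂ σv = σ₁ ^ 2 / σ₂ ^ 2 := by
      rw [ratioLim, ← hgdef, ← h0]
      simpa using e _ hg2
    rw [e2]
    refine tendsto_const_nhds.congr' ?_
    filter_upwards [hα] with N hN
    rw [ldRatio_hypLaw G K J hD, ← h0]
    simpa using (e _ hN).symm
  set ρ : ℕ → ℝ := fun N => responseSq T N (b N).ofLp / ((b N).ofLp ⬝ᵥ (b N).ofLp) with hρ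
  have hρlim : Tendsto ρ atTop (𝓝 (g ^ 2)) := by
    refine tendsto_order.2 ⟨fun c hc => ?_, fun c hc => ?_⟩
    · by_contra hcon
      rw [not_eventually] at hcon
      have hfr := hcon.and_eventually hb
      have hc0 : 0 ≤ c := by
        obtain ⟨N, hN, -⟩ := hfr.exists
        exact (div_nonneg (responseSq_nonneg _ _ _) (dotProduct_self_nonneg' _)).trans
          (not_lt.1 hN)
      have := gain_sq_le_of_frequently hG K J D hc0 (hfr.mono fun N hN b' =>
        (responseSq_le_of_isLDMAP hD h hpos hN.2 b').trans
          (mul_le_mul_of_nonneg_right (not_lt.1 hN.1) (dotProduct_self_nonneg' b')))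
      exact absurd this (not_le.2 hc)
    · filter_upwards [hα] with N hN
      refine lt_of_le_of_lt ?_ hc
      rw [hρ]
      simp only
      rw [div_le_iff₀ (dotProduct_self_pos_of_responseSq_pos hN)]
      exact hle N
  have hlim : Tendsto (fun N => (σ₁ ^ 2 * ρ N + σv ^ 2) / (σ₂ ^ 2 * ρ N + σv ^ 2)) atTop
      (𝓝 (ratioLim G K J D σ₁ σ₂ σv)) :=
    ((hρlim.const_mul _).add_const _).div ((hρlim.const_mul _).add_const _) hden.ne'
  refine hlim.congr' ?_
  filter_upwards [hα] with N hN
  have hβ := dotProduct_self_pos_of_responseSq_pos hN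
  rw [ldRatio_hypLaw G K J hD]
  have e : ∀ s : ℝ, s ^ 2 * ρ N + σv ^ 2 = (s ^ 2 * responseSq T N (b N).ofLp +
      σv ^ 2 * ((b N).ofLp ⬝ᵥ (b N).ofLp)) / ((b N).ofLp ⬝ᵥ (b N).ofLp) := fun s => by
    rw [hρ]
    field_simp
  rw [e, e, div_div_div_cancel_right₀ hβ.ne']

theorem tendsto_ldMapError {G : Matrix (Fin n) (Fin n) ℝ} (hG : IsStable G) (K : Fin r ↪ Fin n)
    (J : Fin m ↪ Fin n) {D : Matrix (Fin r) (Fin r) ℝ} (hD : D.PosDef) {σ₁ σ₂ σv : ℝ}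
    (h : σ₂ ^ 2 < σ₁ ^ 2) (hσv : 0 ≤ σv) (hσ : 0 < σv ∨ 0 < σ₂) (μ : ℝ)
    {b : (N : ℕ) → EuclideanSpace ℝ (Fin N × Fin m)}
    (hb : ∀ᶠ N : ℕ in atTop,
      IsLDMAP (hypLaw G K J D σv N μ σ₁) (hypLaw G K J D σv N μ σ₂) (b N)) :
    Tendsto (fun N => ldMapError (hypLaw G K J D σv N μ σ₁) (hypLaw G K J D σv N μ σ₂) (b N))
      atTop (𝓝 (ratioError (ratioLim G K J D σ₁ σ₂ σv))) := by
  obtain ⟨h1, hlim⟩ := tendsto_ldRatio hG K J hD h hσv hσ μ hb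
  refine ((continuousAt_ratioError h1).tendsto.comp hlim).congr' ?_
  filter_upwards [hb] with N hN
  exact (ldMapError_hypLaw G K J hD h hσ N μ (b N) (responseSq_pos_of_isLDMAP hD h hσ hN)).symm

end CovShift

end NetDet

theorem mainTheorem7 {n r m : ℕ} (G : Matrix (Fin n) (Fin n) ℝ)
    (K : Fin r ↪ Fin n) (J : Fin m ↪ Fin n) (hG : NetDet.IsStable G)
    (D : Matrix (Fin r) (Fin r) ℝ) (hD : D.PosDef) :
    -- mean shift model
    (∀ σc σv : ℝ, 0 < σc → 0 < σv → (∃ k : ℕ, G ^ k = 0) →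
      (∀ (N : ℕ) (μ₁ μ₂ : ℝ),
        NetDet.mapError (NetDet.hypLaw G K J D σv N μ₁ σc) (NetDet.hypLaw G K J D σv N μ₂ σc) =
          NetDet.QNormal ((1 / 2) * Real.sqrt (NetDet.etaSq
            (NetDet.hypLaw G K J D σv N μ₁ σc) (NetDet.hypLaw G K J D σv N μ₂ σc)))) ∧
      (∃ C : ℝ, ∀ (N : ℕ) (μ₁ μ₂ : ℝ),
        |NetDet.etaSq (NetDet.hypLaw G K J D σv N μ₁ σc) (NetDet.hypLaw G K J D σv N μ₂ σc)
          - NetDet.etaSqLim G K J D σc σv N (μ₂ - μ₁)| ≤ C * (μ₂ - μ₁) ^ 2) ∧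
      (∀ μ₁ μ₂ : ℕ → ℝ, Tendsto (fun N => μ₂ N - μ₁ N) atTop (𝓝 0) →
        Tendsto (fun N =>
          NetDet.etaSq (NetDet.hypLaw G K J D σv N (μ₁ N) σc)
            (NetDet.hypLaw G K J D σv N (μ₂ N) σc)
          - NetDet.etaSqLim G K J D σc σv N (μ₂ N - μ₁ N)) atTop (𝓝 0) ∧
        Tendsto (fun N =>
          NetDet.mapError (NetDet.hypLaw G K J D σv N (μ₁ N) σc)
            (NetDet.hypLaw G K J D σv N (μ₂ N) σc)
          - NetDet.QNormal ((1 / 2) *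
              Real.sqrt (NetDet.etaSqLim G K J D σc σv N (μ₂ N - μ₁ N)))) atTop (𝓝 0))) ∧
    -- covariance shift model
    (∀ μc σ₁ σ₂ σv : ℝ, 0 ≤ σ₂ → 0 ≤ σ₁ → σ₂ ^ 2 < σ₁ ^ 2 → 0 ≤ σv → (0 < σv ∨ 0 < σ₂) →
      (0 < NetDet.gain G K J D → ∀ᶠ N : ℕ in atTop, ∃ b,
        NetDet.IsLDMAP (NetDet.hypLaw G K J D σv N μc σ₁)
          (NetDet.hypLaw G K J D σv N μc σ₂) b) ∧
      (∀ b : (N : ℕ) → EuclideanSpace ℝ (Fin N × Fin m),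
        (∀ᶠ N : ℕ in atTop, NetDet.IsLDMAP (NetDet.hypLaw G K J D σv N μc σ₁)
          (NetDet.hypLaw G K J D σv N μc σ₂) (b N)) →
        Tendsto (fun N =>
          NetDet.ldRatio (NetDet.hypLaw G K J D σv N μc σ₁)
            (NetDet.hypLaw G K J D σv N μc σ₂) (b N)) atTop
          (𝓝 (NetDet.ratioLim G K J D σ₁ σ₂ σv)) ∧
        Tendsto (fun N =>
          NetDet.ldMapError (NetDet.hypLaw G K J D σv N μc σ₁)
            (NetDet.hypLaw G K J D σv N μc σ₂) (b N)) atTop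
          (𝓝 (let R := NetDet.ratioLim G K J D σ₁ σ₂ σv
              let τ := Real.log R / (R - 1)
              (1 / 2) * (1 - NetDet.QChiSq τ) + (1 / 2) * NetDet.QChiSq (τ * R))))) := by
  refine ⟨fun σc σv hσc hσv hnil => ?_, fun μc σ₁ σ₂ σv _ _ h hσv hσ => ?_⟩
  · obtain ⟨C, hC⟩ := NetDet.exists_abs_etaSq_sub_le K J hD hσc hσv hnil
    refine ⟨fun N μ₁ μ₂ => NetDet.mapError_hypLaw_mean G K J hD σc hσv N μ₁ μ₂, ⟨C, hC⟩,
      fun μ₁ μ₂ hμ => ?_⟩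
    have hlim : Tendsto (fun N => NetDet.etaSq (NetDet.hypLaw G K J D σv N (μ₁ N) σc)
        (NetDet.hypLaw G K J D σv N (μ₂ N) σc) -
          NetDet.etaSqLim G K J D σc σv N (μ₂ N - μ₁ N)) atTop (𝓝 0) := by
      -- The constant is uniform in `N` and the means, so `μ_Δ → 0` suffices even when `N μ_Δ²` does
      -- not tend to 0.
      refine squeeze_zero_norm (fun N => hC N (μ₁ N) (μ₂ N)) ?_
      simpa using (hμ.pow 2).const_mul C
    refine ⟨hlim, ?_⟩
    simp_rw [NetDet.mapError_hypLaw_mean G K J hD σc hσv]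
    exact NetDet.tendsto_QNormal_sqrt_sub hlim
  · refine ⟨fun hg => ?_, fun b hb => ⟨(NetDet.tendsto_ldRatio hG K J hD h hσv hσ μc hb).2,
      NetDet.tendsto_ldMapError hG K J hD h hσv hσ μc hb⟩⟩
    filter_upwards [NetDet.eventually_exists_responseSq_pos hG K J D hg] with N hN
    obtain ⟨b₀, hb₀⟩ := hN
    exact NetDet.exists_isLDMAP hD h hσ μc hb₀
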